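/- **Setting.** Let $m\ge 1$, $n\ge 0$, $r\ge 1$, and let $f_i,g_i:\mathbb R^n\times\mathbb R^r\to\mathbb R$ $(i=1,\dots,m)$. Put $f=\frac1m\sum_i f_i$, $g=\frac1m\sum_i g_i$, $y^*(x)=\arg\min_y g(x,y)$ and $\Phi(x)=f(x,y^*(x))$. Assume: 1. each $f_i$ is continuously differentiable and jointly $L_{f,1}$-smooth (its gradient in $(x,y)$ is $L_{f,1}$-Lipschitz), and $\|\nabla_y f_i(x,y^*(x))\|\le C_{f,y}$ for all $x$; 2. each $g_i$ is $\mu_g$-strongly convex in $y$ with $\mu_g>0$, jointly $L_{g,1}$-smooth, and twice continuously differentiable with $L_{g,2}$-Lipschitz Hessian in $(x,y)$; 3. $W=(w_{ij})\in\mathbb R^{m\times m}$ is symmetric and doubly stochastic, and for a connected undirected graph on $\{1,\dots,m\}$, in which every node counts as its own neighbour, $w_{ij}>0$ if $i,j$ are neighbours and $w_{ij}=0$ otherwise; put $\rho=\|W-\frac1m 1_m1_m^{\rm T}\|^2$ (spectral norm); 4. for all $x$, at the point $(x,y^*(x))$, $\frac1m\sum_i\|\nabla_x f_i-\nabla_x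 f\|^2\le b_f^2$, $\frac1m\sum_i\|\nabla_y f_i-\nabla_y f\|^2\le b_f^2$, $\frac1m\sum_i\|\nabla_x g_i-\nabla_x g\|^2\le b_g^2$ and $\frac1m\sum_i\|\nabla_y g_i-\nabla_y g\|^2\le b_g^2$. Let $\kappa=\max\{L_{f,1},L_{g,1},C_{f,y}\}/\mu_g$. From initial points $(x_i^0,y_i^0,z_i^0)$ the AHEAD algorithm iterates $$z_i^{k+1}=\sum_j w_{ij}z_j^k-\gamma\nabla_y g_i(x_i^k,z_i^k),\qquad y_i^{k+1}=\sum_j w_{ij}y_j^k-\beta\big(\nabla_y f_i(x_i^k,y_i^k)+\lambda\nabla_y g_i(x_i^k,y_i^k)\big),$$ $$x_i^{k+1}=\sum_j w_{ij}x_j^k-\alpha\big(\nabla_x f_i(x_i^k,y_i^k)+\lambda(\nabla_x g_i(x_i^k,y_i^k)-\nabla_x g_i(x_i^k,z_i^k))\big).$$ Bars denote averages over the nodes. Assume finally that $\Phi$ is bounded below, with $\Phi(\bar x^0)-\inf\Phi\le\Delta$, and that $\|\bar y^0-y^*(\bar x^0)\|^2$, $\|\bar z^0-y^*(\bar x^0)\|^2$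 and the consensus errors $\frac1m\sum_i\|x_i^0-\bar x^0\|^2$, $\frac1m\sum_i\|y_i^0-\bar y^0\|^2$, $\frac1m\sum_i\|z_i^0-\bar z^0\|^2$ are at most $D$. **Claim.** $\Phi$ is differentiable. Let the step sizes and the penalty parameter be of the exact orders $$a\,\kappa^{-3}K^{-2/3}\le\alpha\le a'\kappa^{-3}K^{-2/3},\quad b\,\kappa^{-1}K^{-1/2}\le\beta\le b'\kappa^{-1}K^{-1/2},\quad c\,K^{-1/3}\le\gamma\le c'K^{-1/3},\quad l\,\kappa K^{1/6}\le\lambda\le l'\kappa K^{1/6}$$ with constants $a,b,c,l>0$ and $a',b',c',l'$. Then there is a constant $C>0$ depending only on $L_{f,1},L_{g,1},L_{g,2},C_{f,y}$, the constants $a,a',b,b',c,c',l,l'$, $\Delta$ and $D$ (so not on $\mu_g$, $\kappa$, $\rho$, $b_f$, $b_g$, $K$, $m$, $n$, $r$), and a threshold $K_0$ depending only on the same quantities and on $\mu_g$ and $\rho$, such that for all $K\ge K_0$ $$\frac1K\sum_{k=0}^{K-1}\|\nabla\Phi(\bar x^k)\|^2\le C\left(\frac{\kappa^4}{K^{1/3}}+\frac1{(1-\rho)^2}\left(\frac{\kappa^2b_f^2}{K^{2/3}}+\frac{\kappa^4b_g^2}{K^{1/3}}\right)\right).$$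 -/

import Mathlib

open Finset

noncomputable section

/-- Euclidean space `ℝⁿ`. -/
abbrev Vec (n : ℕ) : Type := EuclideanSpace ℝ (Fin n)

section Regularity

variable {H : Type*} [NormedAddCommGroup H] [InnerProductSpace ℝ H] [CompleteSpace H]

/-- `φ` is continuously differentiable and `L`-smooth: its gradient is `L`-Lipschitz. -/
def SmoothWith (L : ℝ) (φ : H → ℝ) : Prop :=
  ContDiff ℝ 1 φ ∧ ∀ p q, ‖gradient φ p - gradient φ q‖ ≤ L * ‖p - q‖

/-- `φ` is twice continuously differentiable and its Hessian, the derivative of the gradient, is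
`L`-Lipschitz in the operator norm. -/
def HessianLipschitzWith (L : ℝ) (φ : H → ℝ) : Prop :=
  ContDiff ℝ 2 φ ∧
    ∀ p q, ‖fderiv ℝ (gradient φ) p - fderiv ℝ (gradient φ) q‖ ≤ L * ‖p - q‖

end Regularity

section Definitions

/- The spaces of the outer and of the inner variable; in the theorem `ℝⁿ` and `ℝʳ`. -/
variable {X Y : Type*} [NormedAddCommGroup X] [InnerProductSpace ℝ X] [CompleteSpace X]
  [NormedAddCommGroup Y] [InnerProductSpace ℝ Y] [CompleteSpace Y]

/-- The average `(1/m) ∑ᵢ vᵢ` of the local copies held by the `m` nodes. -/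
def nodeAvg {m : ℕ} (v : Fin m → X) : X :=
  (1 / (m : ℝ)) • ∑ i, v i

/-- The mean squared consensus error `(1/m) ∑ᵢ ‖vᵢ - v̄‖²`. -/
def consensusError {m : ℕ} (v : Fin m → X) : ℝ :=
  (1 / (m : ℝ)) * ∑ i, ‖v i - nodeAvg v‖ ^ 2

/-- The global function `h(x,y) = (1/m) ∑ᵢ hᵢ(x,y)`. -/
def meanFun {m : ℕ} (h : Fin m → X → Y → ℝ) (x : X) (y : Y) : ℝ :=
  (1 / (m : ℝ)) * ∑ i, h i x y

/-- Partial gradient `∇ₓ h(x,y)`. -/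
def gradX (h : X → Y → ℝ) (x : X) (y : Y) : X :=
  gradient (fun x' => h x' y) x

/-- Partial gradient `∇_y h(x,y)`. -/
def gradY (h : X → Y → ℝ) (x : X) (y : Y) : Y :=
  gradient (fun y' => h x y') y

/-- `h` as a function of the joint variable `(x,y)`, which carries the Euclidean norm
`‖(x,y)‖² = ‖x‖² + ‖y‖²`. -/
def jointFun (h : X → Y → ℝ) (p : WithLp 2 (X × Y)) : ℝ :=
  h p.fst p.snd

/-- The inner-level solution `y*(x) = argmin_y (1/m) ∑ᵢ gᵢ(x,y)`. -/
def innerSol {m : ℕ} (g : Fin m → X → Y → ℝ) (x : X) : Y :=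
  Classical.epsilon fun y => ∀ y', meanFun g x y ≤ meanFun g x y'

/-- The bilevel objective `Φ(x) = (1/m) ∑ᵢ fᵢ(x, y*(x))`. -/
def bilevelObj {m : ℕ} (f g : Fin m → X → Y → ℝ) (x : X) : ℝ :=
  meanFun f x (innerSol g x)

/-- Outer-level functions: joint `L_{f,1}`-smoothness, and `‖∇_y fᵢ‖ ≤ C_{f,y}` along `(x, y*(x))`. -/
structure OuterAssumption {m : ℕ} (f g : Fin m → X → Y → ℝ) (Lf Cf : ℝ) : Prop where
  smooth : ∀ i, SmoothWith Lf (jointFun (f i))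
  bounded : ∀ i x, ‖gradY (f i) x (innerSol g x)‖ ≤ Cf

/-- Inner-level functions: `μ_g`-strong convexity in `y`, joint `L_{g,1}`-smoothness and a
continuous, `L_{g,2}`-Lipschitz joint Hessian. -/
structure InnerAssumption {m : ℕ} (g : Fin m → X → Y → ℝ) (μ Lg Lg2 : ℝ) : Prop where
  strongConvex : ∀ i x, StrongConvexOn Set.univ μ (fun y => g i x y)
  smooth : ∀ i, SmoothWith Lg (jointFun (g i))
  hessian : ∀ i, HessianLipschitzWith Lg2 (jointFun (g i))

/-- Network: a connected undirected graph whose weight matrix is symmetric and doubly stochastic,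
with positive entries exactly on the edges; every node counts as its own neighbour. -/
structure NetworkAssumption {m : ℕ} (G : SimpleGraph (Fin m)) (W : Matrix (Fin m) (Fin m) ℝ) :
    Prop where
  connected : G.Connected
  symm : ∀ i j, W i j = W j i
  pos : ∀ i j, (i = j ∨ G.Adj i j) → 0 < W i j
  zero : ∀ i j, ¬ (i = j ∨ G.Adj i j) → W i j = 0
  row_sum : ∀ i, ∑ j, W i j = 1
  col_sum : ∀ j, ∑ i, W i j = 1

/-- `ρ = ‖W - (1/m) 1 1ᵀ‖²`, with the spectral norm. -/
def mixingRate {m : ℕ} (W : Matrix (Fin m) (Fin m) ℝ) : ℝ :=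
  ‖Matrix.toEuclideanCLM (n := Fin m) (𝕜 := ℝ)
    (W - Matrix.of fun _ _ => 1 / (m : ℝ))‖ ^ 2

/-- `{∇ₓ hᵢ}` and `{∇_y hᵢ}` have `δ²`-bounded heterogeneity at every point `(x, y*(x))`. -/
def BoundedHeterogeneity {m : ℕ} (h g : Fin m → X → Y → ℝ) (δ : ℝ) : Prop :=
  ∀ x : X,
    (1 / (m : ℝ)) * ∑ i, ‖gradX (h i) x (innerSol g x)
        - gradX (meanFun h) x (innerSol g x)‖ ^ 2 ≤ δ ^ 2 ∧
    (1 / (m : ℝ)) * ∑ i, ‖gradY (h i) x (innerSol g x)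
        - gradY (meanFun h) x (innerSol g x)‖ ^ 2 ≤ δ ^ 2

/-- The condition number `κ = max {L_{f,1}, L_{g,1}, C_{f,y}} / μ_g`. -/
def condNumber (Lf Lg Cf μ : ℝ) : ℝ := max (max Lf Lg) Cf / μ

/-- The local estimates of all nodes at one iteration. -/
structure AheadState (m : ℕ) (X Y : Type*) where
  /-- outer-level variables -/
  x : Fin m → X
  /-- inner-level variables -/
  y : Fin m → Y
  /-- auxiliary variables -/
  z : Fin m → Y

/-- One iteration of AHEAD. -/
def aheadStep {m : ℕ} (W : Matrix (Fin m) (Fin m) ℝ) (f g : Fin m → X → Y → ℝ)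
    (α β γ lam : ℝ) (s : AheadState m X Y) : AheadState m X Y where
  z := fun i => (∑ j, W i j • s.z j) - γ • gradY (g i) (s.x i) (s.z i)
  y := fun i => (∑ j, W i j • s.y j)
    - β • (gradY (f i) (s.x i) (s.y i) + lam • gradY (g i) (s.x i) (s.y i))
  x := fun i => (∑ j, W i j • s.x j)
    - α • (gradX (f i) (s.x i) (s.y i)
      + lam • (gradX (g i) (s.x i) (s.y i) - gradX (g i) (s.x i) (s.z i)))

/-- The state after `k` iterations of AHEAD started from `s₀`. -/
def ahead {m : ℕ} (W : Matrix (Fin m) (Fin m) ℝ) (f g : Fin m → X → Y → ℝ)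
    (α β γ lam : ℝ) (s₀ : AheadState m X Y) (k : ℕ) : AheadState m X Y :=
  (aheadStep W f g α β γ lam)^[k] s₀

/-- Size of the initial state: `Φ(x̄⁰) - Φ(x) ≤ Δ` for all `x` (in particular `Φ` is bounded
below), and the initial inner-level and consensus errors are at most `D`. -/
structure InitialBound {m : ℕ} (f g : Fin m → X → Y → ℝ) (s₀ : AheadState m X Y)
    (Δ D : ℝ) : Prop where
  gap : ∀ x, bilevelObj f g (nodeAvg s₀.x) - bilevelObj f g x ≤ Δ
  err_y : ‖nodeAvg s₀.y - innerSol g (nodeAvg s₀.x)‖ ^ 2 ≤ D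
  err_z : ‖nodeAvg s₀.z - innerSol g (nodeAvg s₀.x)‖ ^ 2 ≤ D
  cons_x : consensusError s₀.x ≤ D
  cons_y : consensusError s₀.y ≤ D
  cons_z : consensusError s₀.z ≤ D

/-- `a` is of exact order `s`, with constants `c ≤ c'`. -/
def OfOrder (c c' s a : ℝ) : Prop := c * s ≤ a ∧ a ≤ c' * s

end Definitions

end

/-! The inner constraint is replaced by a penalty. If y_λ(x) is the zero of ∇_y(f + λg)(x, ·), then
∇ₓf(x,y_λ) + λ(∇ₓg(x,y_λ) − ∇ₓg(x,y*)) approximates ∇Φ(x) with an error of order κ³/λ, using only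
first-order information. `BilevelData.exists_hypergradient` proves this and also constructs ∇Φ
without differentiating y*: with the multiplier w solving ∇²_yy g · w = ∇_y f, the fact that ∇_y g
vanishes all along (x, y*(x)) makes the first-order remainder of Φ quadratic. That single estimate
yields both differentiability and the descent inequality.

AHEAD follows this direction up to consensus errors and the distances of ȳ to y_λ(x̄) and of z̄ to
y*(x̄). Mixing contracts consensus errors because a connected graph forces ρ < 1
(`NetworkAssumption.mixingRate_lt_one`). A gradient step for a strongly monotone field contracts the
distance to its zero (`StronglyMonotoneWith.tracking`), while the target drifts by O(κα‖u‖), where u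
is the averaged outer direction. The dispersion of the local directions is the heterogeneity at (x̄,
y*(x̄)) plus a multiple of the total error. Summed over the iterations these relations form a
coupled linear system, solved in `sum_bound_of_coupled`: small steps absorb the total error, and the
negative ‖u‖² term of the descent inequality pays for the drift.

With t = K^(1/6) all parameters are monomials in κ and t. The squared bias and the g-heterogeneity
term are then of order κ⁴/t², the initial terms of at most this order. Powers of 1/(1−ρ) not
attached to b_f or b_g are swallowed by requiring t ≥ (1−ρ)⁻². -/

noncomputable section

/-! ### Young inequalities with a free weight -/

section Young

variable {H : Type*} [NormedAddCommGroup H]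

/-- The weight stays free so that a small t leaves the main term almost unchanged, to be absorbed by
a contraction, while the perturbation pays 1/t. -/
lemma norm_add_sq_le_young (v w : H) {t : ℝ} (ht : 0 < t) :
    ‖v + w‖ ^ 2 ≤ (1 + t) * ‖v‖ ^ 2 + (1 + 1 / t) * ‖w‖ ^ 2 := by
  have h1 : ‖v + w‖ ^ 2 ≤ (‖v‖ + ‖w‖) ^ 2 := pow_le_pow_left₀ (norm_nonneg _) (norm_add_le _ _) 2
  have h2 : 0 ≤ (t * ‖v‖ - ‖w‖) ^ 2 / t := by positivity
  have h3 : (t * ‖v‖ - ‖w‖) ^ 2 / t = t * ‖v‖ ^ 2 - 2 * ‖v‖ * ‖w‖ + 1 / t * ‖w‖ ^ 2 := by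
    field_simp
    ring
  nlinarith

lemma norm_add_sq_le_two (v w : H) : ‖v + w‖ ^ 2 ≤ 2 * ‖v‖ ^ 2 + 2 * ‖w‖ ^ 2 := by
  have := norm_add_sq_le_young v w one_pos
  norm_num at this
  linarith

lemma norm_sub_sq_le_two (v w : H) : ‖v - w‖ ^ 2 ≤ 2 * ‖v‖ ^ 2 + 2 * ‖w‖ ^ 2 := by
  have := norm_add_sq_le_two v (-w)
  rwa [← sub_eq_add_neg, norm_neg] at this

end Young

/-! ### Strongly monotone fields: zeros, tracking, summed recursions -/

section Monotone

variable {H : Type*} [NormedAddCommGroup H] [InnerProductSpace ℝ H]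

/-- `F` is strongly monotone with modulus `μ`. -/
def StronglyMonotoneWith (μ : ℝ) (F : H → H) : Prop :=
  ∀ p q, μ * ‖p - q‖ ^ 2 ≤ inner ℝ (F p - F q) (p - q)

/-- Cauchy–Schwarz. The perturbation bounds for zeros and multipliers below rest on this inverse
Lipschitz estimate. -/
lemma StronglyMonotoneWith.norm_sub_le {μ : ℝ} {F : H → H} (hF : StronglyMonotoneWith μ F)
    {p q : H} : μ * ‖p - q‖ ≤ ‖F p - F q‖ := by
  rcases eq_or_ne (‖p - q‖) 0 with h | h
  · rw [h]; simp
  · have hpos : 0 < ‖p - q‖ := lt_of_le_of_ne (norm_nonneg _) (Ne.symm h)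
    have h1 := (hF p q).trans (real_inner_le_norm _ _)
    refine le_of_mul_le_mul_right ?_ hpos
    nlinarith

lemma StronglyMonotoneWith.norm_gradStep_sq_le {μ L s : ℝ} {F : H → H}
    (hF : StronglyMonotoneWith μ F) (hL : ∀ p q, ‖F p - F q‖ ≤ L * ‖p - q‖) (hs : 0 ≤ s)
    (p q : H) :
    ‖(p - s • F p) - (q - s • F q)‖ ^ 2 ≤ (1 - 2 * s * μ + s ^ 2 * L ^ 2) * ‖p - q‖ ^ 2 := by
  have e : (p - s • F p) - (q - s • F q) = (p - q) - s • (F p - F q) := by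
    rw [smul_sub]; abel
  rw [e, norm_sub_sq_real, norm_smul, inner_smul_right, real_inner_comm, mul_pow,
    Real.norm_eq_abs, sq_abs]
  have h1 := hF p q
  have h2 : ‖F p - F q‖ ^ 2 ≤ L ^ 2 * ‖p - q‖ ^ 2 := by
    rw [← mul_pow]; exact pow_le_pow_left₀ (norm_nonneg _) (hL p q) 2
  nlinarith [mul_le_mul_of_nonneg_left h1 hs, mul_le_mul_of_nonneg_left h2 (sq_nonneg s)]

/-- A strongly monotone Lipschitz operator on a Hilbert space has a zero. -/
lemma StronglyMonotoneWith.exists_zero [CompleteSpace H] {μ L : ℝ} {F : H → H}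
    (hF : StronglyMonotoneWith μ F) (hμ : 0 < μ) (hL0 : 0 < L)
    (hL : ∀ p q, ‖F p - F q‖ ≤ L * ‖p - q‖) : ∃ p, F p = 0 := by
  -- This step minimises 1 − 2sμ + s²L², with value 1 − μ²/L² < 1, so p ↦ p − sF(p) is a
  -- contraction.
  set s := μ / L ^ 2 with hs
  have hspos : 0 < s := by positivity
  set c := Real.sqrt (1 - 2 * s * μ + s ^ 2 * L ^ 2) with hc
  have e : 1 - 2 * s * μ + s ^ 2 * L ^ 2 = 1 - s * μ := by rw [hs]; field_simp; ring
  have hc1 : c < 1 := by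
    rw [hc, e, Real.sqrt_lt' one_pos]
    nlinarith [mul_pos hspos hμ]
  have hcon : ContractingWith ⟨c, Real.sqrt_nonneg _⟩ (fun p => p - s • F p) := by
    refine ⟨by exact_mod_cast hc1, LipschitzWith.of_dist_le_mul fun p q => ?_⟩
    rw [dist_eq_norm, dist_eq_norm]
    have h1 := hF.norm_gradStep_sq_le hL hspos.le p q
    have h2 := Real.le_sqrt_of_sq_le h1
    rwa [Real.sqrt_mul' _ (sq_nonneg _), Real.sqrt_sq (norm_nonneg _)] at h2
  obtain ⟨p, hp, -⟩ := hcon.exists_fixedPoint 0 (edist_ne_top _ _)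
  refine ⟨p, ?_⟩
  have : s • F p = 0 := by
    have := hp.eq
    simpa using this
  exact (smul_eq_zero.1 this).resolve_left hspos.ne'

/-- One perturbed gradient step towards the zero `v₀`, measured against a moved target `v₁`. -/
lemma StronglyMonotoneWith.tracking {μ L s : ℝ} {F : H → H}
    (hF : StronglyMonotoneWith μ F) (hL : ∀ p q, ‖F p - F q‖ ≤ L * ‖p - q‖) (hμ : 0 < μ)
    (hs : 0 < s) (hsL : s * L ^ 2 ≤ μ) (hsμ : s * μ ≤ 1) {v v₀ v₁ p : H} (h0 : F v₀ = 0) :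
    ‖(v - s • (F v + p)) - v₁‖ ^ 2 ≤ (1 - s * μ / 2) * ‖v - v₀‖ ^ 2
      + 6 / (s * μ) * (s ^ 2 * ‖p‖ ^ 2 + ‖v₁ - v₀‖ ^ 2) := by
  have h1 := hF.norm_gradStep_sq_le hL hs.le v v₀
  rw [h0, smul_zero, sub_zero] at h1
  set q := s * μ with hq
  have hqpos : 0 < q := mul_pos hs hμ
  have h2 : ‖v - s • F v - v₀‖ ^ 2 ≤ (1 - q) * ‖v - v₀‖ ^ 2 := by
    refine h1.trans (mul_le_mul_of_nonneg_right ?_ (sq_nonneg _))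
    nlinarith [mul_le_mul_of_nonneg_left hsL hs.le]
  have e : (v - s • (F v + p)) - v₁ = (v - s • F v - v₀) + (-(s • p) - (v₁ - v₀)) := by
    rw [smul_add]; abel
  -- Half of the contraction is spent on the perturbation: (1 + q/2)(1 − q) ≤ 1 − q/2, at the price
  -- 1 + 2/q ≤ 3/q.
  have h3 := norm_add_sq_le_young (v - s • F v - v₀) (-(s • p) - (v₁ - v₀)) (t := q / 2)
    (by positivity)
  have h4 := norm_sub_sq_le_two (-(s • p)) (v₁ - v₀)
  rw [norm_neg, norm_smul, mul_pow, Real.norm_eq_abs, sq_abs] at h4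
  rw [e]
  have h5 : (1 + q / 2) * ‖v - s • F v - v₀‖ ^ 2 ≤ (1 - q / 2) * ‖v - v₀‖ ^ 2 := by
    have := mul_le_mul_of_nonneg_left h2 (by positivity : 0 ≤ 1 + q / 2)
    refine this.trans ?_
    rw [← mul_assoc]
    refine mul_le_mul_of_nonneg_right ?_ (sq_nonneg _)
    nlinarith [sq_nonneg q]
  have h6 : 1 + 1 / (q / 2) ≤ 3 / q := by
    rw [show 3 / q = 1 / q + 1 / (q / 2) by field_simp; ring]
    have : 1 ≤ 1 / q := by rw [le_div_iff₀ hqpos]; linarith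
    linarith
  have h7 : (1 + 1 / (q / 2)) * ‖-(s • p) - (v₁ - v₀)‖ ^ 2
      ≤ 6 / q * (s ^ 2 * ‖p‖ ^ 2 + ‖v₁ - v₀‖ ^ 2) := by
    calc _ ≤ 3 / q * ‖-(s • p) - (v₁ - v₀)‖ ^ 2 := mul_le_mul_of_nonneg_right h6 (sq_nonneg _)
      _ ≤ 3 / q * (2 * (s ^ 2 * ‖p‖ ^ 2) + 2 * ‖v₁ - v₀‖ ^ 2) :=
          mul_le_mul_of_nonneg_left h4 (by positivity)
      _ = _ := by ring
  linarith

/-- First-order inequality for a differentiable strongly convex function. -/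
lemma StrongConvexOn.inner_gradient_le [CompleteSpace H] {μ : ℝ} {φ : H → ℝ}
    (hφ : StrongConvexOn Set.univ μ φ) {p v : H} (hp : HasGradientAt φ v p) (q : H) :
    φ p + inner ℝ v (q - p) + μ / 2 * ‖q - p‖ ^ 2 ≤ φ q := by
  have hline : HasDerivAt (fun t : ℝ => p + t • (q - p)) (q - p) 0 := by
    simpa using ((hasDerivAt_id (0 : ℝ)).smul_const (q - p)).const_add p
  have hd : HasDerivAt (fun t : ℝ => φ (p + t • (q - p))) (inner ℝ v (q - p)) 0 := by
    have h := hp.hasFDerivAt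
    have h' : HasFDerivAt φ (InnerProductSpace.toDual ℝ H v) (p + (0 : ℝ) • (q - p)) := by
      simpa using h
    have h2 := h'.comp_hasDerivAt (0 : ℝ) hline
    rw [InnerProductSpace.toDual_apply_apply] at h2
    exact h2
  have hd' := hd.tendsto_slope_zero_right
  -- Strong convexity bounds the slope at t ∈ (0,1) by this function; its limit at 0 recovers the
  -- full modulus.
  have hlim : Filter.Tendsto (fun t : ℝ => φ q - φ p - (1 - t) * (μ / 2 * ‖p - q‖ ^ 2))
      (nhdsWithin 0 (Set.Ioi 0)) (nhds (φ q - φ p - (1 - 0) * (μ / 2 * ‖p - q‖ ^ 2))) := by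
    have : Continuous (fun t : ℝ => φ q - φ p - (1 - t) * (μ / 2 * ‖p - q‖ ^ 2)) := by fun_prop
    exact (this.tendsto 0).mono_left nhdsWithin_le_nhds
  have hle := le_of_tendsto_of_tendsto hd' hlim (by
    have : Set.Ioo (0 : ℝ) 1 ∈ nhdsWithin (0 : ℝ) (Set.Ioi 0) := Ioo_mem_nhdsGT one_pos
    filter_upwards [this] with t ht
    have h := hφ.2 (Set.mem_univ p) (Set.mem_univ q) (sub_nonneg.2 ht.2.le) ht.1.le (by ring)
    have e : (1 - t) • p + t • q = p + t • (q - p) := by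
      rw [sub_smul, smul_sub, one_smul]; abel
    rw [e] at h
    simp only [smul_eq_mul] at h
    simp only [zero_add, zero_smul, add_zero, smul_eq_mul]
    rw [inv_mul_le_iff₀ ht.1]
    nlinarith)
  rw [norm_sub_rev p q] at hle
  linarith

lemma StrongConvexOn.inner_gradient_sub_ge [CompleteSpace H] {μ : ℝ} {φ : H → ℝ}
    (hφ : StrongConvexOn Set.univ μ φ) {p q v w : H} (hp : HasGradientAt φ v p)
    (hq : HasGradientAt φ w q) : μ * ‖p - q‖ ^ 2 ≤ inner ℝ (v - w) (p - q) := by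
  have h1 := hφ.inner_gradient_le hp q
  have h2 := hφ.inner_gradient_le hq p
  rw [norm_sub_rev q p] at h1
  have h3 : inner ℝ v (q - p) = - inner ℝ v (p - q) := by rw [← inner_neg_right, neg_sub]
  rw [inner_sub_left]
  linarith

/-- Summation of a contractive recursion. -/
lemma sum_le_of_contractive {e c : ℕ → ℝ} {q : ℝ} (he : ∀ k, 0 ≤ e k)
    (h : ∀ k, e (k + 1) ≤ (1 - q) * e k + c k) (N : ℕ) :
    q * ∑ k ∈ range N, e k ≤ e 0 + ∑ k ∈ range N, c k := by
  -- The induction has to carry the last term, which is discarded only afterwards.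
  have : q * ∑ k ∈ range N, e k + e N ≤ e 0 + ∑ k ∈ range N, c k := by
    induction N with
    | zero => simp
    | succ N ih =>
      rw [sum_range_succ, sum_range_succ]
      linarith [h N]
  linarith [he N]

end Monotone

/-! ### Hypergradient and penalty approximation -/

section Bilevel

lemma pt_ext {X Y : Type*} {p q : WithLp 2 (X × Y)} (h₁ : p.fst = q.fst) (h₂ : p.snd = q.snd) : p = q :=
  WithLp.ofLp_injective 2 (Prod.ext h₁ h₂)

section Norm

variable {X Y : Type*} [NormedAddCommGroup X] [NormedAddCommGroup Y]

/-- The pair `(x,y)` as a point of the Euclidean product. -/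
abbrev pt (x : X) (y : Y) : WithLp 2 (X × Y) := WithLp.toLp 2 (x, y)

lemma pt_sub_pt (x x' : X) (y y' : Y) : pt x y - pt x' y' = pt (x - x') (y - y') := rfl

lemma norm_pt_sq (x : X) (y : Y) : ‖pt x y‖ ^ 2 = ‖x‖ ^ 2 + ‖y‖ ^ 2 :=
  WithLp.prod_norm_sq_eq_of_L2 _

lemma norm_pt_sub_sq (x x' : X) (y y' : Y) :
    ‖pt x y - pt x' y'‖ ^ 2 = ‖x - x'‖ ^ 2 + ‖y - y'‖ ^ 2 := by
  rw [pt_sub_pt, norm_pt_sq]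

lemma norm_pt_zero_left (y : Y) : ‖pt (0 : X) y‖ = ‖y‖ := WithLp.norm_toLp_snd 2 X Y y

lemma norm_pt_sub_left (x : X) (y y' : Y) : ‖pt x y - pt x y'‖ = ‖y - y'‖ := by
  rw [pt_sub_pt, sub_self, norm_pt_zero_left]

lemma norm_pt_sub_right (x x' : X) (y : Y) : ‖pt x y - pt x' y‖ = ‖x - x'‖ := by
  rw [pt_sub_pt, sub_self]; exact WithLp.norm_toLp_fst 2 X Y _

lemma pt_zero_sub (v w : Y) : pt (0 : X) v - pt 0 w = pt 0 (v - w) := by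
  rw [pt_sub_pt, sub_zero]

end Norm

variable {X Y : Type*} [NormedAddCommGroup X] [InnerProductSpace ℝ X]
  [NormedAddCommGroup Y] [InnerProductSpace ℝ Y]

lemma inner_pt_zero_left (p : WithLp 2 (X × Y)) (v : Y) :
    inner ℝ p (pt 0 v) = inner ℝ p.snd v := by
  rw [WithLp.prod_inner_apply]; simp

variable [CompleteSpace X] [CompleteSpace Y]

/-- The first-order data of a smooth outer function `f` (gradient `F`) and of an inner function
with gradient `G` and Hessian `H`, strongly monotone in the second variable. -/
structure BilevelData (L M μ : ℝ) (f : WithLp 2 (X × Y) → ℝ)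
    (F G : WithLp 2 (X × Y) → WithLp 2 (X × Y))
    (H : WithLp 2 (X × Y) → WithLp 2 (X × Y) →L[ℝ] WithLp 2 (X × Y)) : Prop where
  L_pos : 0 < L
  M_nonneg : 0 ≤ M
  μ_pos : 0 < μ
  f_grad : ∀ p, HasGradientAt f (F p) p
  F_lip : ∀ p q, ‖F p - F q‖ ≤ L * ‖p - q‖
  G_lip : ∀ p q, ‖G p - G q‖ ≤ L * ‖p - q‖
  G_deriv : ∀ p, HasFDerivAt G (H p) p
  H_lip : ∀ p q, ‖H p - H q‖ ≤ M * ‖p - q‖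
  H_symm : ∀ p u v, inner ℝ (H p u) v = inner ℝ u (H p v)
  mono : ∀ x, StronglyMonotoneWith μ fun y => (G (pt x y)).snd

namespace BilevelData

variable {L M μ : ℝ} {f : WithLp 2 (X × Y) → ℝ} {F G : WithLp 2 (X × Y) → WithLp 2 (X × Y)}
    {H : WithLp 2 (X × Y) → WithLp 2 (X × Y) →L[ℝ] WithLp 2 (X × Y)}
    (B : BilevelData L M μ f F G H)

include B

lemma norm_hessian_le (p : WithLp 2 (X × Y)) : ‖H p‖ ≤ L := by
  refine (B.G_deriv p).le_of_lip' B.L_pos.le ?_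
  exact Filter.Eventually.of_forall fun q => B.G_lip q p

/-- Mean value inequality on the segment, with the derivative compared to the fixed map `H p`.
Bounding the deviation uniformly on the segment costs the usual factor 1/2, which is immaterial
here. -/
lemma norm_gradient_taylor (p q : WithLp 2 (X × Y)) :
    ‖G q - G p - H p (q - p)‖ ≤ M * ‖q - p‖ ^ 2 := by
  have h := (convex_segment p q).norm_image_sub_le_of_norm_hasFDerivWithin_le'
    (f := G) (f' := H) (φ := H p) (C := M * ‖q - p‖)
    (fun z _ => (B.G_deriv z).hasFDerivWithinAt)
    (fun z hz => (B.H_lip z p).trans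
      (mul_le_mul_of_nonneg_left (norm_sub_le_of_mem_segment hz) B.M_nonneg))
    (left_mem_segment ℝ p q) (right_mem_segment ℝ p q)
  rwa [mul_assoc, ← sq] at h

lemma abs_taylor_le (p q : WithLp 2 (X × Y)) :
    |f q - f p - inner ℝ (F p) (q - p)| ≤ L * ‖q - p‖ ^ 2 := by
  have h := (convex_segment p q).norm_image_sub_le_of_norm_hasFDerivWithin_le'
    (f := f) (f' := fun z => InnerProductSpace.toDual ℝ _ (F z))
    (φ := InnerProductSpace.toDual ℝ _ (F p)) (C := L * ‖q - p‖)
    (fun z _ => (B.f_grad z).hasFDerivAt.hasFDerivWithinAt)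
    (fun z hz => by
      rw [← map_sub, LinearIsometryEquiv.norm_map]
      exact (B.F_lip z p).trans
        (mul_le_mul_of_nonneg_left (norm_sub_le_of_mem_segment hz) B.L_pos.le))
    (left_mem_segment ℝ p q) (right_mem_segment ℝ p q)
  rwa [mul_assoc, ← sq, InnerProductSpace.toDual_apply_apply, Real.norm_eq_abs] at h

/-- Infinitesimal monotonicity: compare y + tv with y, divide by t² and let t → 0⁺. -/
lemma hessian_coercive (p : WithLp 2 (X × Y)) (v : Y) :
    μ * ‖v‖ ^ 2 ≤ inner ℝ (H p (pt 0 v)).snd v := by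
  obtain ⟨x, y⟩ := p
  have hline : HasDerivAt (fun t : ℝ => pt x y + t • pt (0 : X) v) (pt 0 v) 0 := by
    simpa using ((hasDerivAt_id (0 : ℝ)).smul_const (pt (0 : X) v)).const_add (pt x y)
  have hd : HasDerivAt (fun t : ℝ => G (pt x y + t • pt (0 : X) v)) (H (pt x y) (pt 0 v)) 0 := by
    have h' : HasFDerivAt G (H (pt x y)) (pt x y + (0 : ℝ) • pt (0 : X) v) := by
      simpa using B.G_deriv (pt x y)
    exact h'.comp_hasDerivAt (0 : ℝ) hline
  have hlim := hd.tendsto_slope_zero_right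
  have hlim' := Filter.Tendsto.inner (𝕜 := ℝ) hlim (tendsto_const_nhds (x := pt (0 : X) v))
  rw [← inner_pt_zero_left (X := X)]
  refine ge_of_tendsto hlim' ?_
  filter_upwards [self_mem_nhdsWithin] with t ht
  have ht : 0 < t := ht
  have h := B.mono x (y + t • v) y
  simp only [zero_add, zero_smul, add_zero]
  rw [inner_pt_zero_left]
  have e : pt x y + t • pt (0 : X) v = pt x (y + t • v) := by
    exact pt_ext (by simp) (by simp)
  rw [e, WithLp.smul_snd, WithLp.sub_snd, real_inner_smul_left, inv_mul_eq_div, le_div_iff₀ ht]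
  rw [add_sub_cancel_left, norm_smul, mul_pow, real_inner_smul_right, Real.norm_eq_abs, sq_abs] at h
  refine le_of_mul_le_mul_left ?_ ht
  linarith

lemma snd_lip_right (x : X) (y y' : Y) :
    ‖(G (pt x y)).snd - (G (pt x y')).snd‖ ≤ L * ‖y - y'‖ := by
  rw [← WithLp.sub_snd, ← norm_pt_sub_left x]
  exact (WithLp.norm_snd_le _ _).trans (B.G_lip _ _)

lemma penalty_lip_right {lam : ℝ} (hlam : 1 ≤ lam) (x : X) (y y' : Y) :
    ‖(F (pt x y) + lam • G (pt x y)).snd - (F (pt x y') + lam • G (pt x y')).snd‖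
      ≤ 2 * lam * L * ‖y - y'‖ := by
  rw [← WithLp.sub_snd, ← norm_pt_sub_left x]
  refine (WithLp.norm_snd_le _ _).trans ?_
  rw [add_sub_add_comm, ← smul_sub]
  refine (norm_add_le _ _).trans ?_
  rw [norm_smul, Real.norm_of_nonneg (by linarith)]
  have h1 := B.F_lip (pt x y) (pt x y')
  have h2 := mul_le_mul_of_nonneg_left (B.G_lip (pt x y) (pt x y')) (by linarith : 0 ≤ lam)
  have h3 : 0 ≤ L * ‖pt x y - pt x y'‖ := mul_nonneg B.L_pos.le (norm_nonneg _)
  nlinarith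

/-- Once λμ ≥ 2L, the possible non-monotonicity −L of ∇_y f uses up at most half of the modulus λμ.
-/
lemma penalty_mono {lam : ℝ} (hlam : 2 * (L / μ) ≤ lam) (x : X) :
    StronglyMonotoneWith (lam * μ / 2) fun y => (F (pt x y) + lam • G (pt x y)).snd := by
  intro y y'
  have hL : 2 * L ≤ lam * μ := by
    have := mul_le_mul_of_nonneg_right hlam B.μ_pos.le
    rwa [mul_assoc, div_mul_cancel₀ _ B.μ_pos.ne'] at this
  have hlam0 : 0 ≤ lam := le_trans (by have := B.L_pos; have := B.μ_pos; positivity) hlam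
  have h1 := mul_le_mul_of_nonneg_left (B.mono x y y') hlam0
  have h2 : |inner ℝ ((F (pt x y)).snd - (F (pt x y')).snd) (y - y')| ≤ L * ‖y - y'‖ ^ 2 := by
    refine (abs_real_inner_le_norm _ _).trans ?_
    rw [sq, ← mul_assoc]
    refine mul_le_mul_of_nonneg_right ?_ (norm_nonneg _)
    rw [← WithLp.sub_snd, ← norm_pt_sub_left x]
    exact (WithLp.norm_snd_le _ _).trans (B.F_lip _ _)
  have h3 := (abs_le.1 h2).1
  simp only [WithLp.add_snd, WithLp.smul_snd]
  rw [add_sub_add_comm, ← smul_sub, inner_add_left, real_inner_smul_left]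
  nlinarith [mul_le_mul_of_nonneg_right hL (sq_nonneg ‖y - y'‖)]

lemma exists_innerZero (x : X) : ∃ y, (G (pt x y)).snd = 0 :=
  (B.mono x).exists_zero B.μ_pos B.L_pos (B.snd_lip_right x)

lemma exists_penaltyZero {lam : ℝ} (hlam : 2 * (L / μ) ≤ lam) (hlam1 : 1 ≤ lam) (x : X) :
    ∃ y, (F (pt x y) + lam • G (pt x y)).snd = 0 := by
  have hμ := B.μ_pos
  have hL := B.L_pos
  exact (B.penalty_mono hlam x).exists_zero (by positivity) (by positivity)
    (B.penalty_lip_right hlam1 x)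

lemma mu_le : Nontrivial Y → μ ≤ L := by
  intro _
  obtain ⟨v, hv⟩ := exists_ne (0 : Y)
  have h1 := (B.mono 0).norm_sub_le (p := v) (q := 0)
  have h2 := B.snd_lip_right 0 v 0
  rw [sub_zero] at h1 h2
  exact le_of_mul_le_mul_right (h1.trans h2) (norm_pos_iff.2 hv)

variable {ys : X → Y} (hys : ∀ x, (G (pt x (ys x))).snd = 0)

include hys in
-- The zero for x is an approximate zero for x', with residual at most L‖x − x'‖; monotonicity
-- converts the residual into a distance.
lemma innerZero_lip (x x' : X) : ‖ys x - ys x'‖ ≤ L / μ * ‖x - x'‖ := by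
  have h1 := (B.mono x').norm_sub_le (p := ys x) (q := ys x')
  have h2 : ‖(G (pt x' (ys x))).snd - (G (pt x' (ys x'))).snd‖ ≤ L * ‖x - x'‖ := by
    rw [hys x', ← hys x, ← WithLp.sub_snd, norm_sub_rev x x', ← norm_pt_sub_right x' x (ys x)]
    exact (WithLp.norm_snd_le _ _).trans (B.G_lip _ _)
  rw [div_mul_eq_mul_div, le_div_iff₀ B.μ_pos, mul_comm]
  exact h1.trans h2

/-- Lipschitz constant 2λL over modulus λμ/2: λ cancels, so the penalized solution drifts at a rate
uniform in λ. -/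
lemma penaltyZero_lip {lam : ℝ} (hlam : 2 * (L / μ) ≤ lam) (hlam1 : 1 ≤ lam) {yl : X → Y}
    (hyl : ∀ x, (F (pt x (yl x)) + lam • G (pt x (yl x))).snd = 0) (x x' : X) :
    ‖yl x - yl x'‖ ≤ 4 * (L / μ) * ‖x - x'‖ := by
  have hμ := B.μ_pos
  have h1 := (B.penalty_mono hlam x').norm_sub_le (p := yl x) (q := yl x')
  have h2 : ‖(F (pt x' (yl x)) + lam • G (pt x' (yl x))).snd
      - (F (pt x' (yl x')) + lam • G (pt x' (yl x'))).snd‖ ≤ 2 * lam * L * ‖x - x'‖ := by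
    rw [hyl x', ← hyl x, ← WithLp.sub_snd, norm_sub_rev x x', ← norm_pt_sub_right x' x (yl x)]
    refine (WithLp.norm_snd_le _ _).trans ?_
    rw [add_sub_add_comm, ← smul_sub]
    refine (norm_add_le _ _).trans ?_
    rw [norm_smul, Real.norm_of_nonneg (by linarith)]
    have h1 := B.F_lip (pt x' (yl x)) (pt x (yl x))
    have h2 := mul_le_mul_of_nonneg_left (B.G_lip (pt x' (yl x)) (pt x (yl x)))
      (by linarith : 0 ≤ lam)
    have h3 : 0 ≤ L * ‖pt x' (yl x) - pt x (yl x)‖ := mul_nonneg B.L_pos.le (norm_nonneg _)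
    nlinarith
  have h3 := h1.trans h2
  have e : 4 * (L / μ) * ‖x - x'‖ = 2 * lam * L * ‖x - x'‖ / (lam * μ / 2) := by
    have : lam ≠ 0 := by linarith
    field_simp
    ring
  rw [e, le_div_iff₀ (by positivity)]
  linarith

variable (hF : ∀ x, ‖(F (pt x (ys x))).snd‖ ≤ L)

include hys hF in
-- At y*(x) the penalty field reduces to ∇_y f, of norm at most L, whereas its modulus is λμ/2.
lemma norm_penaltyZero_sub_le {lam : ℝ} (hlam : 2 * (L / μ) ≤ lam) (hlam1 : 1 ≤ lam) {x : X}
    {y : Y} (hy : (F (pt x y) + lam • G (pt x y)).snd = 0) :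
    ‖y - ys x‖ ≤ 2 * (L / μ) / lam := by
  have hμ := B.μ_pos
  have h1 := (B.penalty_mono hlam x).norm_sub_le (p := y) (q := ys x)
  simp only [hy, zero_sub, norm_neg] at h1
  rw [WithLp.add_snd, WithLp.smul_snd, hys x, smul_zero, add_zero] at h1
  have h2 := h1.trans (hF x)
  have e : 2 * (L / μ) / lam = L / (lam * μ / 2) := by
    have : lam ≠ 0 := by linarith
    field_simp
  rw [e, le_div_iff₀ (by positivity)]
  linarith

/-- The multiplier `w` with `∇²_yy g · w = ∇_y f`. -/
lemma exists_multiplier (p : WithLp 2 (X × Y)) :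
    ∃ w : Y, (H p (pt 0 w)).snd = (F p).snd ∧ μ * ‖w‖ ≤ ‖(F p).snd‖ := by
  -- Solving the linear equation means finding a zero of this affine field, so `exists_zero` plays
  -- the role of Lax–Milgram.
  have hmono : StronglyMonotoneWith μ fun w : Y => (H p (pt 0 w)).snd - (F p).snd := by
    intro v w
    simp only
    rw [sub_sub_sub_cancel_right, ← WithLp.sub_snd, ← map_sub, pt_zero_sub]
    exact B.hessian_coercive p (v - w)
  obtain ⟨w, hw⟩ := hmono.exists_zero B.μ_pos B.L_pos (fun v w => by
    rw [sub_sub_sub_cancel_right, ← WithLp.sub_snd, ← map_sub, pt_zero_sub]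
    refine (WithLp.norm_snd_le _ _).trans (((H p).le_opNorm _).trans ?_)
    rw [norm_pt_zero_left]
    exact mul_le_mul_of_nonneg_right (B.norm_hessian_le p) (norm_nonneg _))
  refine ⟨w, sub_eq_zero.1 hw, ?_⟩
  have h := hmono.norm_sub_le (p := w) (q := 0)
  rw [hw] at h
  have e : pt (0 : X) (0 : Y) = 0 := rfl
  rwa [e, map_zero, WithLp.zero_snd, sub_sub_cancel, sub_zero] at h

include hys hF in
/-- There is a hypergradient: it gives a quadratically accurate first-order expansion of
`x ↦ f(x, y*(x))`, and the gradient of the penalty function approximates it. -/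
lemma exists_hypergradient : ∃ h : X → X,
    (∀ x x', |f (pt x' (ys x')) - f (pt x (ys x)) - inner ℝ (h x) (x' - x)|
      ≤ (L + L / μ * M) * (1 + (L / μ) ^ 2) * ‖x' - x‖ ^ 2) ∧
    ∀ lam : ℝ, 2 * (L / μ) ≤ lam → 1 ≤ lam → ∀ x y,
      (F (pt x y) + lam • G (pt x y)).snd = 0 →
      ‖h x - ((F (pt x y)).fst + lam • ((G (pt x y)).fst - (G (pt x (ys x))).fst))‖
        ≤ (1 + L / μ) * (2 * L * (L / μ) / lam + 4 * M * (L / μ) ^ 2 / lam) := by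
  have hμ := B.μ_pos
  have hL := B.L_pos
  have hM := B.M_nonneg
  have hκ : 0 < L / μ := div_pos hL hμ
  choose w hw hwn using fun x => B.exists_multiplier (pt x (ys x))
  have hwn' : ∀ x, ‖w x‖ ≤ L / μ := fun x => by
    rw [le_div_iff₀ hμ, mul_comm]; exact (hwn x).trans (hF x)
  set h : X → X := fun x => (F (pt x (ys x)) - H (pt x (ys x)) (pt 0 (w x))).fst with hh
  -- The multiplier cancels the y-component of the gradient of f; the remaining x-component is the
  -- hypergradient ∇ₓf − ∇²_xy g · w.
  have hdec : ∀ x, F (pt x (ys x)) = pt (h x) 0 + H (pt x (ys x)) (pt 0 (w x)) := by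
    intro x
    rw [← sub_eq_iff_eq_add]
    have h2 : (F (pt x (ys x)) - H (pt x (ys x)) (pt 0 (w x))).snd = 0 := by
      rw [WithLp.sub_snd, hw, sub_self]
    exact pt_ext rfl h2
  refine ⟨h, fun x x' => ?_, fun lam hlam hlam1 x y hy => ?_⟩
  · set p := pt x (ys x) with hp
    set q := pt x' (ys x') with hq
    have h1 := B.abs_taylor_le p q
    have h2 := B.norm_gradient_taylor p q
    have hδ : ‖q - p‖ ^ 2 ≤ (1 + (L / μ) ^ 2) * ‖x' - x‖ ^ 2 := by
      rw [hp, hq, norm_pt_sub_sq]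
      have := pow_le_pow_left₀ (norm_nonneg _) (B.innerZero_lip hys x' x) 2
      rw [mul_pow] at this
      linarith
    have e1 : inner ℝ (F p) (q - p) = inner ℝ (h x) (x' - x)
        + inner ℝ (pt 0 (w x)) (H p (q - p)) := by
      rw [hdec x, inner_add_left, B.H_symm]
      congr 1
      rw [hp, hq, pt_sub_pt, WithLp.prod_inner_apply]
      simp
    -- Key cancellation: ∇_y g is zero at both p and q, so the pairing of (0,w) with the Hessian
    -- increment is, up to sign, its pairing with a Taylor remainder, hence quadratic.
    have e2 : inner ℝ (pt 0 (w x)) (H p (q - p))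
        = -inner ℝ (pt 0 (w x)) (G q - G p - H p (q - p)) := by
      rw [inner_sub_right]
      have : inner ℝ (pt 0 (w x)) (G q - G p) = 0 := by
        rw [real_inner_comm, inner_pt_zero_left, WithLp.sub_snd, hys, hys, sub_self,
          inner_zero_left]
      rw [this]; ring
    have h3 : |inner ℝ (pt 0 (w x)) (H p (q - p))| ≤ L / μ * (M * ‖q - p‖ ^ 2) := by
      rw [e2, abs_neg]
      refine (abs_real_inner_le_norm _ _).trans ?_
      rw [norm_pt_zero_left]
      exact mul_le_mul (hwn' x) h2 (norm_nonneg _) hκ.le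
    have h4 : |f q - f p - inner ℝ (h x) (x' - x)| ≤ (L + L / μ * M) * ‖q - p‖ ^ 2 := by
      have e3 : f q - f p - inner ℝ (h x) (x' - x)
          = (f q - f p - inner ℝ (F p) (q - p)) + inner ℝ (pt 0 (w x)) (H p (q - p)) := by
        rw [e1]; ring
      rw [e3]
      refine (abs_add_le _ _).trans ?_
      linarith
    refine h4.trans ?_
    rw [mul_assoc]
    exact mul_le_mul_of_nonneg_left hδ (by positivity)
  · set p := pt x (ys x) with hp
    have hlam0 : 0 < lam := by linarith
    have hd := B.norm_penaltyZero_sub_le hys hF hlam hlam1 hy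
    set d := (F (pt x y)).fst + lam • ((G (pt x y)).fst - (G p).fst) with hdd
    -- λ(y* − y) is an approximate multiplier, and v is its defect. Below, (d − h, 0) = H(0,v) + R:
    -- the y-component with coercivity gives ‖v‖ ≤ ‖R‖/μ, and the whole identity then bounds d − h.
    set v := w x + lam • (y - ys x) with hv
    set R := (F (pt x y) - F p) + lam • (G (pt x y) - G p - H p (pt x y - p)) with hR
    have e0 : pt x y - p = pt 0 (y - ys x) := by rw [hp, pt_sub_pt, sub_self]
    have e1 : pt d 0 = F (pt x y) + lam • (G (pt x y) - G p) := by
      have : (F (pt x y) + lam • (G (pt x y) - G p)).snd = 0 := by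
        rw [WithLp.add_snd, WithLp.smul_snd, WithLp.sub_snd, hys, sub_zero]; exact hy
      rw [← this]; rfl
    have e3 : H p (pt 0 v) = H p (pt 0 (w x)) + lam • H p (pt x y - p) := by
      rw [e0, ← map_smul, ← map_add]; congr 1; exact pt_ext (by simp) (by simp [hv])
    have e2 : pt (d - h x) (0 : Y) = H p (pt 0 v) + R := by
      have : pt (d - h x) (0 : Y) = pt d 0 - pt (h x) 0 := by rw [pt_sub_pt, sub_zero]
      rw [this, e1, e3, hR, eq_sub_of_add_eq (hdec x).symm]
      module
    have hRn : ‖R‖ ≤ 2 * L * (L / μ) / lam + 4 * M * (L / μ) ^ 2 / lam := by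
      refine (norm_add_le _ _).trans (add_le_add ?_ ?_)
      · refine (B.F_lip _ _).trans ?_
        rw [hp, norm_pt_sub_left]
        calc _ ≤ L * (2 * (L / μ) / lam) := mul_le_mul_of_nonneg_left hd hL.le
          _ = _ := by ring
      · rw [norm_smul, Real.norm_of_nonneg hlam0.le]
        have h2 := B.norm_gradient_taylor p (pt x y)
        have h3 := pow_le_pow_left₀ (norm_nonneg _) hd 2
        rw [← norm_pt_sub_left x, ← hp] at h3
        calc _ ≤ lam * (M * (2 * (L / μ) / lam) ^ 2) :=
            mul_le_mul_of_nonneg_left (h2.trans (mul_le_mul_of_nonneg_left h3 hM)) hlam0.le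
          _ = _ := by field_simp; ring
    have hvn : μ * ‖v‖ ≤ ‖R‖ := by
      have h1 := B.hessian_coercive p v
      have h2 : (H p (pt 0 v)).snd = -R.snd := by
        have := congrArg WithLp.snd e2
        rw [WithLp.add_snd] at this
        exact eq_neg_of_add_eq_zero_left this.symm
      rw [h2, inner_neg_left] at h1
      have h3 := (abs_le.1 (abs_real_inner_le_norm R.snd v)).1
      have h4 : ‖R.snd‖ ≤ ‖R‖ := WithLp.norm_snd_le _ _
      rcases eq_or_ne (‖v‖) 0 with h0 | h0
      · rw [h0]; simp
      · have hpos : 0 < ‖v‖ := lt_of_le_of_ne (norm_nonneg _) (Ne.symm h0)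
        refine le_of_mul_le_mul_right ?_ hpos
        nlinarith
    have h5 : ‖h x - d‖ ≤ (1 + L / μ) * ‖R‖ := by
      rw [norm_sub_rev, ← sub_zero (d - h x), ← norm_pt_sub_right _ _ (0 : Y), pt_sub_pt, sub_zero, sub_zero, e2]
      refine (norm_add_le _ _).trans ?_
      have h6 : ‖H p (pt 0 v)‖ ≤ L * ‖v‖ := by
        refine ((H p).le_opNorm _).trans ?_
        rw [norm_pt_zero_left]
        exact mul_le_mul_of_nonneg_right (B.norm_hessian_le p) (norm_nonneg _)
      have h7 : L * ‖v‖ ≤ L / μ * ‖R‖ := by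
        rw [div_mul_eq_mul_div, le_div_iff₀ hμ]
        nlinarith
      linarith
    exact h5.trans (mul_le_mul_of_nonneg_left hRn (by positivity))

end BilevelData

end Bilevel

/-! ### Mean squares and averages over the nodes -/

section MeanSquare

variable {m : ℕ} {X Y Z : Type*} [NormedAddCommGroup X] [NormedAddCommGroup Y]
  [NormedAddCommGroup Z]

/-- The mean square `(1/m) ∑ᵢ ‖vᵢ‖²`. -/
def meanSq (v : Fin m → X) : ℝ := (1 / (m : ℝ)) * ∑ i, ‖v i‖ ^ 2

lemma meanSq_nonneg (v : Fin m → X) : 0 ≤ meanSq v := by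
  unfold meanSq; positivity

lemma meanSq_le_add {u : Fin m → X} {v : Fin m → Y} {w : Fin m → Z} {a b : ℝ}
    (h : ∀ i, ‖u i‖ ^ 2 ≤ a * ‖v i‖ ^ 2 + b * ‖w i‖ ^ 2) :
    meanSq u ≤ a * meanSq v + b * meanSq w := by
  have h1 : ∑ i, ‖u i‖ ^ 2 ≤ a * ∑ i, ‖v i‖ ^ 2 + b * ∑ i, ‖w i‖ ^ 2 := by
    rw [mul_sum, mul_sum, ← sum_add_distrib]
    exact sum_le_sum fun i _ => h i
  have h2 := mul_le_mul_of_nonneg_left h1 (by positivity : 0 ≤ 1 / (m : ℝ))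
  unfold meanSq
  linarith

lemma meanSq_le_mul {u : Fin m → X} {v : Fin m → Y} {a : ℝ}
    (h : ∀ i, ‖u i‖ ^ 2 ≤ a * ‖v i‖ ^ 2) : meanSq u ≤ a * meanSq v := by
  have := meanSq_le_add (u := u) (v := v) (w := v) (a := a) (b := 0) (by simpa using h)
  simpa using this

lemma meanSq_add_le_two (v w : Fin m → X) :
    meanSq (fun i => v i + w i) ≤ 2 * meanSq v + 2 * meanSq w :=
  meanSq_le_add fun _ => norm_add_sq_le_two _ _

lemma meanSq_sub_le_two (v w : Fin m → X) :
    meanSq (fun i => v i - w i) ≤ 2 * meanSq v + 2 * meanSq w :=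
  meanSq_le_add fun _ => norm_sub_sq_le_two _ _

lemma meanSq_add_le_three (u v w : Fin m → X) :
    meanSq (fun i => u i + v i + w i) ≤ 3 * meanSq u + 3 * meanSq v + 3 * meanSq w := by
  have h1 : meanSq (fun i => u i + v i + w i) ≤ 3 / 2 * meanSq (fun i => u i + v i)
      + 3 * meanSq w := meanSq_le_add fun i => by
    have := norm_add_sq_le_young (u i + v i) (w i) (t := 1 / 2) (by norm_num)
    norm_num at this
    exact this
  linarith [meanSq_add_le_two u v]

end MeanSquare

section Averages

variable {m : ℕ} {X : Type*} [NormedAddCommGroup X] [InnerProductSpace ℝ X]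

lemma consensusError_eq_meanSq (v : Fin m → X) :
    consensusError v = meanSq fun i => v i - nodeAvg v := rfl

lemma consensusError_nonneg (v : Fin m → X) : 0 ≤ consensusError v := meanSq_nonneg _

lemma meanSq_smul (c : ℝ) (v : Fin m → X) : meanSq (fun i => c • v i) = c ^ 2 * meanSq v := by
  simp only [meanSq, norm_smul, mul_pow, Real.norm_eq_abs, sq_abs, ← mul_sum]
  ring

lemma nodeAvg_add (v w : Fin m → X) :
    nodeAvg (fun i => v i + w i) = nodeAvg v + nodeAvg w := by
  simp only [nodeAvg, sum_add_distrib, smul_add]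

lemma nodeAvg_sub (v w : Fin m → X) :
    nodeAvg (fun i => v i - w i) = nodeAvg v - nodeAvg w := by
  simp only [nodeAvg, sum_sub_distrib, smul_sub]

lemma nodeAvg_smul (c : ℝ) (v : Fin m → X) :
    nodeAvg (fun i => c • v i) = c • nodeAvg v := by
  simp only [nodeAvg, ← smul_sum]
  rw [smul_comm]

lemma nodeAvg_map {Z : Type*} [NormedAddCommGroup Z] [InnerProductSpace ℝ Z] (T : X →ₗ[ℝ] Z)
    (v : Fin m → X) : nodeAvg (fun i => T (v i)) = T (nodeAvg v) := by
  simp only [nodeAvg, map_smul, map_sum]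

lemma nodeAvg_const (hm : 0 < m) (c : X) : nodeAvg (fun _ : Fin m => c) = c := by
  have : (m : ℝ) ≠ 0 := by positivity
  simp only [nodeAvg, sum_const, card_univ, Fintype.card_fin]
  rw [← Nat.cast_smul_eq_nsmul ℝ, smul_smul, one_div, inv_mul_cancel₀ this, one_smul]

lemma sum_eq_smul_nodeAvg (hm : 0 < m) (v : Fin m → X) : ∑ i, v i = (m : ℝ) • nodeAvg v := by
  have : (m : ℝ) ≠ 0 := by positivity
  rw [nodeAvg, smul_smul, one_div, mul_inv_cancel₀ this, one_smul]

/-- Variance decomposition: the cross term vanishes because deviations from the average sum to zero.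
-/
lemma meanSq_sub_const (hm : 0 < m) (v : Fin m → X) (c : X) :
    meanSq (fun i => v i - c) = consensusError v + ‖nodeAvg v - c‖ ^ 2 := by
  have hm' : (m : ℝ) ≠ 0 := by positivity
  have h0 : ∑ i, (v i - nodeAvg v) = 0 := by
    rw [sum_sub_distrib, sum_eq_smul_nodeAvg hm v]
    simp [← Nat.cast_smul_eq_nsmul ℝ]
  have h : ∀ i, ‖v i - c‖ ^ 2 = ‖v i - nodeAvg v‖ ^ 2
      + 2 * inner ℝ (v i - nodeAvg v) (nodeAvg v - c) + ‖nodeAvg v - c‖ ^ 2 := fun i => by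
    rw [← norm_add_sq_real, sub_add_sub_cancel]
  simp only [meanSq, consensusError, h, sum_add_distrib, ← mul_sum, ← sum_inner, h0,
    inner_zero_left, sum_const, card_univ, Fintype.card_fin, nsmul_eq_mul]
  field_simp
  ring

/-- Allows dispersion to be measured around any convenient reference, here a mean gradient at (x̄,
y*(x̄)). -/
lemma consensusError_le_meanSq_sub (hm : 0 < m) (v : Fin m → X) (c : X) :
    consensusError v ≤ meanSq fun i => v i - c := by
  rw [meanSq_sub_const hm]
  linarith [sq_nonneg ‖nodeAvg v - c‖]

lemma norm_nodeAvg_sq_le (hm : 0 < m) (v : Fin m → X) : ‖nodeAvg v‖ ^ 2 ≤ meanSq v := by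
  have h := meanSq_sub_const hm v 0
  simp only [sub_zero] at h
  linarith [consensusError_nonneg v]

lemma norm_average_le {Z : Type*} [NormedAddCommGroup Z] [NormedSpace ℝ Z] {v : Fin m → Z} {c : ℝ}
    (hm : 0 < m) (h : ∀ i, ‖v i‖ ≤ c) : ‖(1 / (m : ℝ)) • ∑ i, v i‖ ≤ c := by
  have hm' : (0 : ℝ) < m := by positivity
  rw [norm_smul, Real.norm_of_nonneg (by positivity), one_div, inv_mul_le_iff₀ hm']
  refine (norm_sum_le _ _).trans ((sum_le_sum fun i _ => h i).trans ?_)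
  simp

lemma norm_nodeAvg_le {v : Fin m → X} {c : ℝ} (hm : 0 < m) (h : ∀ i, ‖v i‖ ≤ c) :
    ‖nodeAvg v‖ ≤ c :=
  norm_average_le hm h

end Averages

/-! ### Contraction by the mixing matrix -/

section Mixing

variable {m n : ℕ} {G : SimpleGraph (Fin m)} {W : Matrix (Fin m) (Fin m) ℝ}

lemma NetworkAssumption.node_pos (hW : NetworkAssumption G W) : 0 < m := by
  obtain ⟨i⟩ := hW.connected.nonempty
  exact i.pos

lemma NetworkAssumption.nonneg (hW : NetworkAssumption G W) (i j : Fin m) : 0 ≤ W i j := by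
  by_cases h : i = j ∨ G.Adj i j
  · exact (hW.pos i j h).le
  · exact (hW.zero i j h).ge

lemma NetworkAssumption.sum_sub_avg (hW : NetworkAssumption G W) {X : Type*}
    [NormedAddCommGroup X] [InnerProductSpace ℝ X] (v : Fin m → X) (i : Fin m) :
    ∑ j, W i j • (v j - nodeAvg v) = (∑ j, W i j • v j) - nodeAvg v := by
  simp only [smul_sub, sum_sub_distrib, ← sum_smul, hW.row_sum, one_smul]

lemma sum_deviation {X : Type*}
    [NormedAddCommGroup X] [InnerProductSpace ℝ X] (v : Fin m → X) (i : Fin m) :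
    ∑ j, (W i j - 1 / (m : ℝ)) • v j = (∑ j, W i j • v j) - nodeAvg v := by
  simp only [sub_smul, sum_sub_distrib, nodeAvg, smul_sum]

lemma NetworkAssumption.nodeAvg_mix (hW : NetworkAssumption G W) {X : Type*}
    [NormedAddCommGroup X] [InnerProductSpace ℝ X] (v : Fin m → X) :
    nodeAvg (fun i => ∑ j, W i j • v j) = nodeAvg v := by
  simp only [nodeAvg]
  rw [sum_comm]
  simp only [← sum_smul, hW.col_sum, one_smul]

lemma toEuclideanCLM_deviation_apply (v : EuclideanSpace ℝ (Fin m)) (i : Fin m) :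
    Matrix.toEuclideanCLM (n := Fin m) (𝕜 := ℝ) (W - Matrix.of fun _ _ => 1 / (m : ℝ)) v i
      = ∑ j, (W i j - 1 / (m : ℝ)) * v j := by
  rw [Matrix.ofLp_toEuclideanCLM]; rfl

/-- Averaging over the network does not increase the sum of squares, and only constant vectors
keep it. -/
lemma NetworkAssumption.eq_of_sum_sq_le (hW : NetworkAssumption G W) (u : Fin m → ℝ)
    (h : ∑ i, u i ^ 2 ≤ ∑ i, (∑ j, W i j * u j) ^ 2) (i j : Fin m) : u i = u j := by
  set a : Fin m → ℝ := fun i => ∑ j, W i j * u j with ha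
  -- Row i is a probability vector with mean a i. By the column sums the total of these variances is
  -- ‖u‖² − ‖Wu‖², so under `h` they all vanish.
  have hvar : ∀ i, ∑ j, W i j * (u j - a i) ^ 2 = ∑ j, W i j * u j ^ 2 - a i ^ 2 := fun i => by
    have e : ∀ j, W i j * (u j - a i) ^ 2
        = W i j * u j ^ 2 - 2 * a i * (W i j * u j) + a i ^ 2 * W i j := fun j => by ring
    simp only [e, sum_add_distrib, sum_sub_distrib, ← mul_sum, hW.row_sum]
    change _ - 2 * a i * a i + _ = _
    ring
  have hsum : ∑ i, ∑ j, W i j * u j ^ 2 = ∑ j, u j ^ 2 := by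
    rw [sum_comm]
    simp only [← sum_mul, hW.col_sum, one_mul]
  have hnn : ∀ i j, 0 ≤ W i j * (u j - a i) ^ 2 := fun i j =>
    mul_nonneg (hW.nonneg i j) (sq_nonneg _)
  have htot : ∑ i, ∑ j, W i j * (u j - a i) ^ 2 ≤ 0 := by
    simp only [hvar, sum_sub_distrib, hsum]
    linarith
  have hz : ∀ i j, W i j * (u j - a i) ^ 2 = 0 := fun i j => by
    have h1 := (sum_eq_zero_iff_of_nonneg fun i _ => sum_nonneg fun j _ => hnn i j).1
      (le_antisymm htot (sum_nonneg fun i _ => sum_nonneg fun j _ => hnn i j)) i (mem_univ _)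
    exact (sum_eq_zero_iff_of_nonneg fun j _ => hnn i j).1 h1 j (mem_univ _)
  -- Since i is its own neighbour, u i = a i too; hence u agrees across edges and, by connectedness,
  -- everywhere.
  have hea : ∀ i j, (i = j ∨ G.Adj i j) → u j = a i := fun i j hij => by
    have := (mul_eq_zero.1 (hz i j)).resolve_left (hW.pos i j hij).ne'
    exact sub_eq_zero.1 (pow_eq_zero_iff (two_ne_zero)|>.1 this)
  obtain ⟨p⟩ := hW.connected.preconnected i j
  induction p with
  | nil => rfl
  | cons hadj _ ih => rw [hea _ _ (Or.inl rfl), ← hea _ _ (Or.inr hadj), ih]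

/-- W − J with J = (1/m)11ᵀ acts on v as W acts on the centred vector u. Without strict decrease u
would be constant, hence 0 because its sum is 0, and then v = 0. -/
lemma NetworkAssumption.norm_deviation_lt (hW : NetworkAssumption G W)
    (v : EuclideanSpace ℝ (Fin m)) (hv : v ≠ 0) :
    ‖Matrix.toEuclideanCLM (n := Fin m) (𝕜 := ℝ)
      (W - Matrix.of fun _ _ => 1 / (m : ℝ)) v‖ < ‖v‖ := by
  have hm := hW.node_pos
  have hm' : (0 : ℝ) < m := by positivity
  by_contra hcon
  push Not at hcon
  have h1 := pow_le_pow_left₀ (norm_nonneg _) hcon 2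
  rw [EuclideanSpace.real_norm_sq_eq, EuclideanSpace.real_norm_sq_eq] at h1
  simp only [toEuclideanCLM_deviation_apply] at h1
  set c : ℝ := nodeAvg fun i => v i with hc
  set u : Fin m → ℝ := fun i => v i - c with hu
  have h2 : ∀ i, ∑ j, (W i j - 1 / (m : ℝ)) * v j = ∑ j, W i j * u j := fun i => by
    have ha := hW.sum_sub_avg (fun j => v j) i
    have hb := sum_deviation (W := W) (fun j => v j) i
    simp only [smul_eq_mul] at ha hb
    rw [hb, ← ha]
  simp only [h2] at h1
  have h3 : ∑ i, v i ^ 2 = ∑ i, u i ^ 2 + m * c ^ 2 := by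
    have h := meanSq_sub_const hm (fun i => v i) (0 : ℝ)
    simp only [meanSq, consensusError, sub_zero, Real.norm_eq_abs, sq_abs] at h
    field_simp at h
    exact h
  have h4 := hW.eq_of_sum_sq_le u (by nlinarith [sq_nonneg c])
  have h5 : ∀ i, u i = 0 := fun i => by
    have hsum : ∑ j, u j = 0 := by
      simp only [hu, sum_sub_distrib, sum_const, card_univ, Fintype.card_fin, nsmul_eq_mul]
      rw [sum_eq_smul_nodeAvg hm, smul_eq_mul, sub_self]
    rw [sum_congr rfl fun j _ => h4 j i] at hsum
    simp only [sum_const, card_univ, Fintype.card_fin, nsmul_eq_mul] at hsum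
    exact (mul_eq_zero.1 hsum).resolve_left hm'.ne'
  simp only [h5] at h1 h3
  simp only [mul_zero, sum_const_zero, ne_eq, OfNat.ofNat_ne_zero, not_false_eq_true, zero_pow]
    at h1 h3
  apply hv
  ext i
  have h6 := (sum_eq_zero_iff_of_nonneg fun i _ => sq_nonneg (v i)).1
    (le_antisymm h1 (sum_nonneg fun i _ => sq_nonneg (v i))) i (mem_univ _)
  simpa using h6

lemma mixingRate_nonneg : 0 ≤ mixingRate W := sq_nonneg _

/-- Averaging over a connected network is a strict contraction towards consensus. -/
lemma NetworkAssumption.mixingRate_lt_one (hW : NetworkAssumption G W) : mixingRate W < 1 := by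
  have : NeZero m := ⟨hW.node_pos.ne'⟩
  set T := Matrix.toEuclideanCLM (n := Fin m) (𝕜 := ℝ)
    (W - Matrix.of fun _ _ => 1 / (m : ℝ)) with hT
  -- Compactness of the unit sphere upgrades the pointwise strict inequality to a strict bound on
  -- the operator norm.
  obtain ⟨v, hv, hmax⟩ := (isCompact_sphere (0 : EuclideanSpace ℝ (Fin m)) 1).exists_isMaxOn
    (NormedSpace.sphere_nonempty.2 zero_le_one) (f := fun v => ‖T v‖) (by fun_prop)
  have hv1 : ‖v‖ = 1 := by simpa using hv
  have h1 : ‖T v‖ < 1 := by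
    have := hW.norm_deviation_lt v (by rintro rfl; simp at hv1)
    rwa [hv1] at this
  have h2 : ‖T‖ ≤ ‖T v‖ := ContinuousLinearMap.opNorm_le_of_unit_norm (norm_nonneg _)
    fun w hw => hmax (by simpa using hw)
  exact pow_lt_one₀ (norm_nonneg _) (h2.trans_lt h1) two_ne_zero

/-- The matrix acts only on the node index, so the scalar operator bound applies to each coordinate
separately. -/
lemma sum_norm_sq_deviation_le (v : Fin m → Vec n) :
    ∑ i, ‖∑ j, (W i j - 1 / (m : ℝ)) • v j‖ ^ 2 ≤ mixingRate W * ∑ i, ‖v i‖ ^ 2 := by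
  simp only [EuclideanSpace.real_norm_sq_eq, WithLp.ofLp_sum, WithLp.ofLp_smul, Finset.sum_apply,
    Pi.smul_apply, smul_eq_mul]
  rw [sum_comm, sum_comm (s := univ) (t := univ) (f := fun i c => v i c ^ 2), mul_sum]
  refine sum_le_sum fun c _ => ?_
  set w : EuclideanSpace ℝ (Fin m) := WithLp.toLp 2 fun i => v i c with hw
  have h := pow_le_pow_left₀ (norm_nonneg _) ((Matrix.toEuclideanCLM (n := Fin m) (𝕜 := ℝ)
    (W - Matrix.of fun _ _ => 1 / (m : ℝ))).le_opNorm w) 2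
  rw [mul_pow, EuclideanSpace.real_norm_sq_eq, EuclideanSpace.real_norm_sq_eq w] at h
  simp only [toEuclideanCLM_deviation_apply] at h
  exact h

lemma NetworkAssumption.meanSq_mix_sub_avg_le (hW : NetworkAssumption G W)
    (v : Fin m → Vec n) :
    meanSq (fun i => (∑ j, W i j • v j) - nodeAvg v) ≤ mixingRate W * consensusError v := by
  have hm := hW.node_pos
  have h := sum_norm_sq_deviation_le (W := W) fun i => v i - nodeAvg v
  have e : nodeAvg (fun i => v i - nodeAvg v) = 0 := by
    rw [nodeAvg_sub, nodeAvg_const hm, sub_self]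
  have e2 : ∀ i, ∑ j, (W i j - 1 / (m : ℝ)) • (v j - nodeAvg v)
      = (∑ j, W i j • v j) - nodeAvg v := fun i => by
    rw [sum_deviation, e, sub_zero, hW.sum_sub_avg]
  simp only [e2] at h
  rw [meanSq, consensusError, mul_left_comm]
  exact mul_le_mul_of_nonneg_left h (by positivity)

/-- Consensus error after one mixing step followed by local steps along `g`. -/
lemma NetworkAssumption.consensusError_step_le (hW : NetworkAssumption G W)
    (v g : Fin m → Vec n) (s : ℝ) :
    consensusError (fun i => (∑ j, W i j • v j) - s • g i)
      ≤ (1 + mixingRate W) / 2 * consensusError v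
        + 3 / (1 - mixingRate W) * (s ^ 2 * consensusError g) := by
  set ρ := mixingRate W with hρ
  have hρ0 : 0 ≤ ρ := mixingRate_nonneg
  have hρ1 : 0 < 1 - ρ := sub_pos.2 hW.mixingRate_lt_one
  have e : nodeAvg (fun i => (∑ j, W i j • v j) - s • g i) = nodeAvg v - s • nodeAvg g := by
    rw [nodeAvg_sub, nodeAvg_smul, hW.nodeAvg_mix]
  have h1 : consensusError (fun i => (∑ j, W i j • v j) - s • g i)
      ≤ (1 + (1 - ρ) / 2) * meanSq (fun i => (∑ j, W i j • v j) - nodeAvg v)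
        + (1 + 1 / ((1 - ρ) / 2)) * (s ^ 2 * consensusError g) := by
    rw [consensusError_eq_meanSq g, ← meanSq_smul, consensusError_eq_meanSq, e]
    refine meanSq_le_add fun i => ?_
    -- The weight (1−ρ)/2 sacrifices half of the spectral gap: (1 + (1−ρ)/2)ρ ≤ (1+ρ)/2.
    have := norm_add_sq_le_young ((∑ j, W i j • v j) - nodeAvg v) (-(s • (g i - nodeAvg g)))
      (t := (1 - ρ) / 2) (by positivity)
    rw [norm_neg] at this
    convert this using 3
    rw [smul_sub]; abel
  have h2 := mul_le_mul_of_nonneg_left (hW.meanSq_mix_sub_avg_le v)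
    (by positivity : 0 ≤ 1 + (1 - ρ) / 2)
  have h3 : (1 + (1 - ρ) / 2) * (ρ * consensusError v) ≤ (1 + ρ) / 2 * consensusError v := by
    rw [← mul_assoc]
    refine mul_le_mul_of_nonneg_right ?_ (consensusError_nonneg _)
    nlinarith
  have h4 : 1 + 1 / ((1 - ρ) / 2) ≤ 3 / (1 - ρ) := by
    rw [show 1 / ((1 - ρ) / 2) = 2 / (1 - ρ) by field_simp,
      show 3 / (1 - ρ) = 1 / (1 - ρ) + 2 / (1 - ρ) by ring]
    have : 1 ≤ 1 / (1 - ρ) := by rw [le_div_iff₀ hρ1]; linarith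
    linarith
  have h5 := mul_le_mul_of_nonneg_right h4
    (mul_nonneg (sq_nonneg s) (consensusError_nonneg g))
  linarith

end Mixing

/-! ### Partial gradients as components of the joint gradient -/

section JointGradients

variable {X Y : Type*} [NormedAddCommGroup X] [InnerProductSpace ℝ X] [CompleteSpace X]
  [NormedAddCommGroup Y] [InnerProductSpace ℝ Y] [CompleteSpace Y]

lemma hasGradientAt_fst {h : X → Y → ℝ} {x : X} {y : Y} {v : WithLp 2 (X × Y)}
    (hd : HasGradientAt (jointFun h) v (pt x y)) : HasGradientAt (fun x' => h x' y) v.fst x := by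
  have h1 : HasFDerivAt (fun x' : X => pt x' y)
      ((WithLp.prodContinuousLinearEquiv 2 ℝ X Y).symm.toContinuousLinearMap.comp
        ((ContinuousLinearMap.id ℝ X).prod 0)) x :=
    (WithLp.prodContinuousLinearEquiv 2 ℝ X Y).symm.hasFDerivAt.comp x
      ((hasFDerivAt_id x).prodMk (hasFDerivAt_const y x))
  have h2 := hd.hasFDerivAt.comp x h1
  rw [hasGradientAt_iff_hasFDerivAt]
  refine h2.congr_fderiv ?_
  ext w
  simp [WithLp.prodContinuousLinearEquiv_symm_apply]

lemma hasGradientAt_snd {h : X → Y → ℝ} {x : X} {y : Y} {v : WithLp 2 (X × Y)}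
    (hd : HasGradientAt (jointFun h) v (pt x y)) : HasGradientAt (fun y' => h x y') v.snd y := by
  have h1 : HasFDerivAt (fun y' : Y => pt x y')
      ((WithLp.prodContinuousLinearEquiv 2 ℝ X Y).symm.toContinuousLinearMap.comp
        ((0 : Y →L[ℝ] X).prod (ContinuousLinearMap.id ℝ Y))) y :=
    (WithLp.prodContinuousLinearEquiv 2 ℝ X Y).symm.hasFDerivAt.comp y
      ((hasFDerivAt_const x y).prodMk (hasFDerivAt_id y))
  have h2 := hd.hasFDerivAt.comp y h1
  rw [hasGradientAt_iff_hasFDerivAt]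
  refine h2.congr_fderiv ?_
  ext w
  simp [WithLp.prodContinuousLinearEquiv_symm_apply]

lemma HasGradientAt.gradX_eq {h : X → Y → ℝ} {x : X} {y : Y} {v : WithLp 2 (X × Y)}
    (hd : HasGradientAt (jointFun h) v (pt x y)) : gradX h x y = v.fst :=
  (hasGradientAt_fst hd).gradient

lemma HasGradientAt.gradY_eq {h : X → Y → ℝ} {x : X} {y : Y} {v : WithLp 2 (X × Y)}
    (hd : HasGradientAt (jointFun h) v (pt x y)) : gradY h x y = v.snd :=
  (hasGradientAt_snd hd).gradient

/-- The gradient of the `i`-th joint function. -/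
def nodeGrad {m : ℕ} (h : Fin m → X → Y → ℝ) (i : Fin m) (p : WithLp 2 (X × Y)) :
    WithLp 2 (X × Y) :=
  gradient (jointFun (h i)) p

/-- The average of the joint gradients. -/
def meanGrad {m : ℕ} (h : Fin m → X → Y → ℝ) (p : WithLp 2 (X × Y)) : WithLp 2 (X × Y) :=
  nodeAvg fun i => nodeGrad h i p

variable {m : ℕ} {h : Fin m → X → Y → ℝ}

lemma SmoothWith.hasGradientAt_nodeGrad {L : ℝ} {i : Fin m} (hs : SmoothWith L (jointFun (h i)))
    (p : WithLp 2 (X × Y)) : HasGradientAt (jointFun (h i)) (nodeGrad h i p) p :=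
  ((hs.1.differentiable one_ne_zero) p).hasGradientAt

lemma hasGradientAt_meanGrad {p : WithLp 2 (X × Y)}
    (hd : ∀ i, HasGradientAt (jointFun (h i)) (nodeGrad h i p) p) :
    HasGradientAt (jointFun (meanFun h)) (meanGrad h p) p := by
  rw [hasGradientAt_iff_hasFDerivAt]
  have h1 := (HasFDerivAt.fun_sum (u := univ) fun i _ => (hd i).hasFDerivAt).const_mul
    (1 / (m : ℝ))
  refine (h1.congr_fderiv ?_)
  simp [meanGrad, nodeAvg]

lemma fst_meanGrad (p : WithLp 2 (X × Y)) :
    (meanGrad h p).fst = nodeAvg fun i => (nodeGrad h i p).fst :=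
  (nodeAvg_map (WithLp.fstₗ 2 ℝ X Y) fun i => nodeGrad h i p).symm

lemma snd_meanGrad (p : WithLp 2 (X × Y)) :
    (meanGrad h p).snd = nodeAvg fun i => (nodeGrad h i p).snd :=
  (nodeAvg_map (WithLp.sndₗ 2 ℝ X Y) fun i => nodeGrad h i p).symm

lemma norm_meanGrad_sub_le {L : ℝ} (hm : 0 < m)
    (hL : ∀ i p q, ‖nodeGrad h i p - nodeGrad h i q‖ ≤ L * ‖p - q‖) (p q : WithLp 2 (X × Y)) :
    ‖meanGrad h p - meanGrad h q‖ ≤ L * ‖p - q‖ := by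
  rw [meanGrad, meanGrad, ← nodeAvg_sub]
  exact norm_nodeAvg_le hm fun i => hL i p q

end JointGradients

/-! ### From the assumptions to the first-order data -/

section Assumptions

variable {X Y : Type*} [NormedAddCommGroup X] [InnerProductSpace ℝ X] [CompleteSpace X]
  [NormedAddCommGroup Y] [InnerProductSpace ℝ Y] [CompleteSpace Y]
  {m : ℕ} {f g : Fin m → X → Y → ℝ} {Lf Lg Lg2 Cf μ : ℝ}

lemma differentiable_gradient_of_contDiff {H : Type*} [NormedAddCommGroup H]
    [InnerProductSpace ℝ H] [CompleteSpace H] {φ : H → ℝ} (hφ : ContDiff ℝ 2 φ) :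
    Differentiable ℝ (gradient φ) := by
  have h1 : Differentiable ℝ (fderiv ℝ φ) :=
    (hφ.fderiv_right (m := 1) (by norm_num)).differentiable one_ne_zero
  exact (InnerProductSpace.toDual ℝ H).symm.toContinuousLinearEquiv.differentiable.comp h1

lemma inner_fderiv_gradient {H : Type*} [NormedAddCommGroup H]
    [InnerProductSpace ℝ H] [CompleteSpace H] {φ : H → ℝ} (hφ : ContDiff ℝ 2 φ) (p u v : H) :
    inner ℝ (fderiv ℝ (gradient φ) p u) v = fderiv ℝ (fderiv ℝ φ) p u v := by
  have h1 := (differentiable_gradient_of_contDiff hφ p).hasFDerivAt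
  have h2 := (InnerProductSpace.toDual ℝ H).toContinuousLinearEquiv.hasFDerivAt.comp p h1
  have e : (InnerProductSpace.toDual ℝ H).toContinuousLinearEquiv ∘ gradient φ = fderiv ℝ φ :=
    toDual_comp_gradient
  rw [e] at h2
  rw [h2.fderiv]
  simp

/-- Symmetry of the second derivative, transported through the Riesz isometry. -/
lemma fderiv_gradient_symm {H : Type*} [NormedAddCommGroup H]
    [InnerProductSpace ℝ H] [CompleteSpace H] {φ : H → ℝ} (hφ : ContDiff ℝ 2 φ) (p u v : H) :
    inner ℝ (fderiv ℝ (gradient φ) p u) v = inner ℝ u (fderiv ℝ (gradient φ) p v) := by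
  have hs : IsSymmSndFDerivAt ℝ φ p := hφ.contDiffAt.isSymmSndFDerivAt (by simp)
  rw [real_inner_comm, ← real_inner_comm u, inner_fderiv_gradient hφ, real_inner_comm,
    inner_fderiv_gradient hφ]
  exact hs u v

lemma InnerAssumption.mono_snd (hg : InnerAssumption g μ Lg Lg2) (i : Fin m) (x : X) :
    StronglyMonotoneWith μ fun y => (nodeGrad g i (pt x y)).snd := fun _ _ =>
  (hg.strongConvex i x).inner_gradient_sub_ge
    (hasGradientAt_snd ((hg.smooth i).hasGradientAt_nodeGrad _))
    (hasGradientAt_snd ((hg.smooth i).hasGradientAt_nodeGrad _))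

lemma nodeAvg_mono {u v : Fin m → ℝ} (h : ∀ i, u i ≤ v i) : nodeAvg u ≤ nodeAvg v := by
  unfold nodeAvg
  exact smul_le_smul_of_nonneg_left (sum_le_sum fun i _ => h i) (by positivity)

lemma nodeAvg_inner {Z : Type*} [NormedAddCommGroup Z] [InnerProductSpace ℝ Z] (v : Fin m → Z)
    (w : Z) : nodeAvg (fun i => inner ℝ (v i) w) = inner ℝ (nodeAvg v) w := by
  simp [nodeAvg, sum_inner, inner_smul_left]

lemma InnerAssumption.mono_mean (hg : InnerAssumption g μ Lg Lg2) (hm : 0 < m) (x : X) :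
    StronglyMonotoneWith μ fun y => (meanGrad g (pt x y)).snd := by
  intro y y'
  have h := nodeAvg_mono fun i => hg.mono_snd i x y y'
  rwa [nodeAvg_const hm, nodeAvg_inner, nodeAvg_sub, ← snd_meanGrad, ← snd_meanGrad] at h

lemma InnerAssumption.mu_le (hg : InnerAssumption g μ Lg Lg2) [Nontrivial Y] (hm : 0 < m) :
    μ ≤ Lg := by
  obtain ⟨v, hv⟩ := exists_ne (0 : Y)
  have h1 := (hg.mono_snd ⟨0, hm⟩ 0).norm_sub_le (p := v) (q := 0)
  have h2 : ‖(nodeGrad g ⟨0, hm⟩ (pt 0 v)).snd - (nodeGrad g ⟨0, hm⟩ (pt (0 : X) 0)).snd‖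
      ≤ Lg * ‖v - 0‖ := by
    rw [← WithLp.sub_snd, ← norm_pt_sub_left (0 : X)]
    exact (WithLp.norm_snd_le _ _).trans ((hg.smooth _).2 _ _)
  rw [sub_zero] at h1 h2
  exact le_of_mul_le_mul_right (h1.trans h2) (norm_pos_iff.2 hv)

lemma InnerAssumption.hessianConst_nonneg (hg : InnerAssumption g μ Lg Lg2) [Nontrivial Y]
    (hm : 0 < m) : 0 ≤ Lg2 := by
  obtain ⟨v, hv⟩ := exists_ne (0 : Y)
  have h := (norm_nonneg _).trans ((hg.hessian ⟨0, hm⟩).2 (pt 0 v) (pt 0 0))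
  rw [norm_pt_sub_left, sub_zero] at h
  exact nonneg_of_mul_nonneg_left h (norm_pos_iff.2 hv)

/-- The inner-level solution is the zero of the averaged partial gradient. -/
lemma InnerAssumption.snd_meanGrad_innerSol (hg : InnerAssumption g μ Lg Lg2) (hμ : 0 < μ)
    {x : X} (hz : ∃ y, (meanGrad g (pt x y)).snd = 0) :
    (meanGrad g (pt x (innerSol g x))).snd = 0 := by
  have hgrad : ∀ y, HasGradientAt (meanFun g x) (meanGrad g (pt x y)).snd y := fun y =>
    hasGradientAt_snd (hasGradientAt_meanGrad fun i => (hg.smooth i).hasGradientAt_nodeGrad _)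
  obtain ⟨y₀, hy₀⟩ := hz
  -- A critical point is a minimiser by convexity. Hence the choice in `innerSol` really selects a
  -- minimiser, to which Fermat's rule applies.
  have hmin : ∃ y, ∀ y', meanFun g x y ≤ meanFun g x y' := by
    refine ⟨y₀, fun y' => ?_⟩
    have h1 : ∀ i, g i x y₀ + inner ℝ (nodeGrad g i (pt x y₀)).snd (y' - y₀) ≤ g i x y' :=
      fun i => by
        have := (hg.strongConvex i x).inner_gradient_le
          (hasGradientAt_snd ((hg.smooth i).hasGradientAt_nodeGrad (pt x y₀))) y'
        have h2 : 0 ≤ μ / 2 * ‖y' - y₀‖ ^ 2 := by positivity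
        linarith
    have h2 := nodeAvg_mono h1
    rw [nodeAvg_add, nodeAvg_inner, ← snd_meanGrad, hy₀, inner_zero_left, add_zero] at h2
    exact h2
  have h3 : ∀ y', meanFun g x (innerSol g x) ≤ meanFun g x y' := Classical.epsilon_spec hmin
  have h4 : IsLocalMin (meanFun g x) (innerSol g x) := Filter.Eventually.of_forall h3
  have h5 := h4.hasFDerivAt_eq_zero (hgrad _).hasFDerivAt
  simpa using h5

/-- The assumptions on `f` and `g`, in terms of the joint gradients and with one common
constant. -/
theorem bilevelData_of_assumptions (hf : OuterAssumption f g Lf Cf)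
    (hg : InnerAssumption g μ Lg Lg2) [Nontrivial Y] (hμ : 0 < μ) (hm : 0 < m) {L : ℝ}
    (hLf : Lf ≤ L) (hLg : Lg ≤ L) :
    BilevelData L Lg2 μ (jointFun (meanFun f)) (meanGrad f) (meanGrad g)
      (fun p => fderiv ℝ (meanGrad g) p) := by
  have hgd : ∀ i, Differentiable ℝ (nodeGrad g i) := fun i =>
    differentiable_gradient_of_contDiff (hg.hessian i).1
  have hder : ∀ p, HasFDerivAt (meanGrad g) ((1 / (m : ℝ)) • ∑ i, fderiv ℝ (nodeGrad g i) p) p :=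
    fun p => (HasFDerivAt.fun_sum (u := univ) fun i _ => (hgd i p).hasFDerivAt).const_smul
      (1 / (m : ℝ))
  have hψ : ContDiff ℝ 2 (jointFun (meanFun g)) := by
    have : ContDiff ℝ 2 fun p => (1 / (m : ℝ)) * ∑ i, jointFun (g i) p :=
      contDiff_const.mul (ContDiff.sum fun i _ => (hg.hessian i).1)
    exact this
  have hgr : gradient (jointFun (meanFun g)) = meanGrad g := funext fun p =>
    (hasGradientAt_meanGrad fun i => (hg.smooth i).hasGradientAt_nodeGrad p).gradient
  exact
    { L_pos := (hμ.trans_le (hg.mu_le hm)).trans_le hLg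
      M_nonneg := hg.hessianConst_nonneg hm
      μ_pos := hμ
      f_grad := fun p => hasGradientAt_meanGrad fun i => (hf.smooth i).hasGradientAt_nodeGrad p
      F_lip := norm_meanGrad_sub_le hm fun i p q => ((hf.smooth i).2 p q).trans
        (mul_le_mul_of_nonneg_right hLf (norm_nonneg _))
      G_lip := norm_meanGrad_sub_le hm fun i p q => ((hg.smooth i).2 p q).trans
        (mul_le_mul_of_nonneg_right hLg (norm_nonneg _))
      G_deriv := fun p => (hder p).differentiableAt.hasFDerivAt
      H_lip := fun p q => by
        have h := norm_average_le hm fun i => (hg.hessian i).2 p q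
        rw [sum_sub_distrib, smul_sub] at h
        rw [(hder p).fderiv, (hder q).fderiv]
        exact h
      H_symm := fun p u v => by
        rw [← hgr]; exact fderiv_gradient_symm hψ p u v
      mono := hg.mono_mean hm }

end Assumptions

/-! ### Descent and differentiability from a quadratic remainder -/

section Descent

variable {H : Type*} [NormedAddCommGroup H] [InnerProductSpace ℝ H]

/-- Descent along an inexact gradient `u`. -/
lemma descent_of_quadratic_bound {Φ : H → ℝ} {h : H → H} {B α : ℝ}
    (hΦ : ∀ x x', |Φ x' - Φ x - inner ℝ (h x) (x' - x)| ≤ B * ‖x' - x‖ ^ 2) (hα : 0 < α)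
    (hαB : α * B ≤ 1 / 4) (x u : H) :
    Φ (x - α • u) ≤ Φ x - α / 2 * ‖h x‖ ^ 2 - α / 4 * ‖u‖ ^ 2 + α / 2 * ‖h x - u‖ ^ 2 := by
  have h1 := (abs_le.1 (hΦ x (x - α • u))).2
  rw [sub_sub_cancel_left, norm_neg, norm_smul, mul_pow, Real.norm_eq_abs, sq_abs,
    inner_neg_right, real_inner_smul_right] at h1
  have h2 := norm_sub_sq_real (h x) u
  -- Only half of −(α/2)‖u‖² is used for the remainder; the other half is kept to pay later for the
  -- drift of the inner targets.
  have h3 : B * (α ^ 2 * ‖u‖ ^ 2) ≤ α / 4 * ‖u‖ ^ 2 := by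
    nlinarith [mul_le_mul_of_nonneg_left hαB (mul_nonneg hα.le (sq_nonneg ‖u‖))]
  rw [h2]
  nlinarith

lemma hasGradientAt_of_quadratic_bound [CompleteSpace H] {Φ : H → ℝ} {h : H → H} {B : ℝ}
    (hΦ : ∀ x x', |Φ x' - Φ x - inner ℝ (h x) (x' - x)| ≤ B * ‖x' - x‖ ^ 2) (x : H) :
    HasGradientAt Φ (h x) x := by
  rw [hasGradientAt_iff_isLittleO]
  have h1 : (fun x' => Φ x' - Φ x - inner ℝ (h x) (x' - x)) =O[nhds x]
      fun x' => ‖x' - x‖ ^ 2 :=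
    Asymptotics.IsBigO.of_bound B (Filter.Eventually.of_forall fun x' => by
      rw [Real.norm_eq_abs, norm_pow, norm_norm]; exact hΦ x x')
  refine h1.trans_isLittleO ?_
  have h2 : (fun x' => ‖x' - x‖ ^ 2) =o[nhds x] fun x' => ‖x' - x‖ := by
    have h3 : Filter.Tendsto (fun x' => ‖x' - x‖) (nhds x) (nhds 0) := by
      have : Continuous fun x' => ‖x' - x‖ := by fun_prop
      simpa using this.tendsto x
    have h4 := (Asymptotics.isLittleO_one_iff ℝ).2 h3
    have h5 := h4.mul_isBigO (Asymptotics.isBigO_refl (fun x' => ‖x' - x‖) (nhds x))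
    simpa [sq] using h5
  exact h2.of_norm_right

end Descent

/-- The assumptions on the problem and on the network, with one smoothness constant and in terms of
joint gradients. -/
structure AheadSetting {m n r : ℕ} (L M μ bf bg : ℝ) (G : SimpleGraph (Fin m))
    (W : Matrix (Fin m) (Fin m) ℝ) (f g : Fin m → Vec n → Vec r → ℝ) : Prop where
  data : BilevelData L M μ (jointFun (meanFun f)) (meanGrad f) (meanGrad g)
    (fun p => fderiv ℝ (meanGrad g) p)
  f_lip : ∀ i p q, ‖nodeGrad f i p - nodeGrad f i q‖ ≤ L * ‖p - q‖
  g_lip : ∀ i p q, ‖nodeGrad g i p - nodeGrad g i q‖ ≤ L * ‖p - q‖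
  f_grad : ∀ i p, HasGradientAt (jointFun (f i)) (nodeGrad f i p) p
  g_grad : ∀ i p, HasGradientAt (jointFun (g i)) (nodeGrad g i p) p
  ys_zero : ∀ x, (meanGrad g (pt x (innerSol g x))).snd = 0
  f_bound : ∀ x, ‖(meanGrad f (pt x (innerSol g x))).snd‖ ≤ L
  het_f : BoundedHeterogeneity f g bf
  het_g : BoundedHeterogeneity g g bg
  net : NetworkAssumption G W

section MeanSquareProd

variable {m : ℕ} {X Y : Type*} [NormedAddCommGroup X] [NormedAddCommGroup Y]

lemma meanSq_le_of_norm_le {Z Z' : Type*} [NormedAddCommGroup Z] [NormedAddCommGroup Z']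
    {v : Fin m → Z} {w : Fin m → Z'} {c : ℝ} (h : ∀ i, ‖v i‖ ≤ c * ‖w i‖) :
    meanSq v ≤ c ^ 2 * meanSq w :=
  meanSq_le_mul fun i => by
    rw [← mul_pow]; exact pow_le_pow_left₀ (norm_nonneg _) (h i) 2

lemma meanSq_fst_le (v : Fin m → WithLp 2 (X × Y)) : meanSq (fun i => (v i).fst) ≤ meanSq v := by
  have := meanSq_le_mul (u := fun i => (v i).fst) (v := v) (a := 1) fun i => by
    rw [one_mul]; exact pow_le_pow_left₀ (norm_nonneg _) (WithLp.norm_fst_le _ _) 2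
  simpa using this

lemma meanSq_snd_le (v : Fin m → WithLp 2 (X × Y)) : meanSq (fun i => (v i).snd) ≤ meanSq v := by
  have := meanSq_le_mul (u := fun i => (v i).snd) (v := v) (a := 1) fun i => by
    rw [one_mul]; exact pow_le_pow_left₀ (norm_nonneg _) (WithLp.norm_snd_le _ _) 2
  simpa using this

end MeanSquareProd

lemma meanSq_pt_sub {m : ℕ} {X Y : Type*} [NormedAddCommGroup X] [InnerProductSpace ℝ X]
    [NormedAddCommGroup Y] [InnerProductSpace ℝ Y] (hm : 0 < m) (x : Fin m → X) (y : Fin m → Y) (y₀ : Y) :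
    meanSq (fun i => pt (x i) (y i) - pt (nodeAvg x) y₀)
      = consensusError x + consensusError y + ‖nodeAvg y - y₀‖ ^ 2 := by
  rw [add_assoc, ← meanSq_sub_const hm]
  simp only [meanSq, consensusError, norm_pt_sub_sq, sum_add_distrib, mul_add]

/-! ### Local directions: dispersion and one-step recursions -/

section Directions

variable {m : ℕ} {X Y : Type*} [NormedAddCommGroup X] [InnerProductSpace ℝ X] [CompleteSpace X]
  [NormedAddCommGroup Y] [InnerProductSpace ℝ Y] [CompleteSpace Y]

/-- Local direction of the auxiliary variables. -/
def dirZ (g : Fin m → X → Y → ℝ) (s : AheadState m X Y) (i : Fin m) : Y :=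
  (nodeGrad g i (pt (s.x i) (s.z i))).snd

/-- Local direction of the inner variables. -/
def dirY (f g : Fin m → X → Y → ℝ) (lam : ℝ) (s : AheadState m X Y) (i : Fin m) : Y :=
  (nodeGrad f i (pt (s.x i) (s.y i)) + lam • nodeGrad g i (pt (s.x i) (s.y i))).snd

/-- Local direction of the outer variables. -/
def dirX (f g : Fin m → X → Y → ℝ) (lam : ℝ) (s : AheadState m X Y) (i : Fin m) : X :=
  (nodeGrad f i (pt (s.x i) (s.y i)) + lam • (nodeGrad g i (pt (s.x i) (s.y i))
    - nodeGrad g i (pt (s.x i) (s.z i)))).fst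

/-- The sum of the consensus errors and of the squared distances of the averages to the penalized
and to the exact inner solution. -/
def totalErr (g : Fin m → X → Y → ℝ) (yl : X → Y) (s : AheadState m X Y) : ℝ :=
  consensusError s.x + consensusError s.y + consensusError s.z
    + ‖nodeAvg s.y - yl (nodeAvg s.x)‖ ^ 2 + ‖nodeAvg s.z - innerSol g (nodeAvg s.x)‖ ^ 2

end Directions

namespace AheadSetting

variable {m n r : ℕ} {L M μ bf bg : ℝ} {G : SimpleGraph (Fin m)}
    {W : Matrix (Fin m) (Fin m) ℝ} {f g : Fin m → Vec n → Vec r → ℝ}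
    (S : AheadSetting L M μ bf bg G W f g) (s : AheadState m (Vec n) (Vec r)) {lam : ℝ}

include S

lemma aheadStep_z (α β γ lam : ℝ) : (aheadStep W f g α β γ lam s).z
    = fun i => (∑ j, W i j • s.z j) - γ • dirZ g s i := by
  funext i
  simp only [aheadStep, dirZ, (S.g_grad i _).gradY_eq]

lemma aheadStep_y (α β γ lam : ℝ) : (aheadStep W f g α β γ lam s).y
    = fun i => (∑ j, W i j • s.y j) - β • dirY f g lam s i := by
  funext i
  simp only [aheadStep, dirY, (S.g_grad i _).gradY_eq, (S.f_grad i _).gradY_eq, WithLp.add_snd,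
    WithLp.smul_snd]

lemma aheadStep_x (α β γ lam : ℝ) : (aheadStep W f g α β γ lam s).x
    = fun i => (∑ j, W i j • s.x j) - α • dirX f g lam s i := by
  funext i
  simp only [aheadStep, dirX, (S.g_grad i _).gradX_eq, (S.f_grad i _).gradX_eq, WithLp.add_fst,
    WithLp.smul_fst, WithLp.sub_fst]

lemma nodeAvg_mix_sub {k : ℕ} (v d : Fin m → Vec k) (a : ℝ) :
    nodeAvg (fun i => (∑ j, W i j • v j) - a • d i) = nodeAvg v - a • nodeAvg d := by
  rw [nodeAvg_sub, nodeAvg_smul, S.net.nodeAvg_mix]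

lemma het_fst_f (x : Vec n) :
    meanSq (fun i => (nodeGrad f i (pt x (innerSol g x)) - meanGrad f (pt x (innerSol g x))).fst)
      ≤ bf ^ 2 := by
  have h := (S.het_f x).1
  rw [(hasGradientAt_meanGrad fun i => S.f_grad i _).gradX_eq] at h
  simp only [(S.f_grad _ _).gradX_eq] at h
  exact h

lemma het_snd_f (x : Vec n) :
    meanSq (fun i => (nodeGrad f i (pt x (innerSol g x)) - meanGrad f (pt x (innerSol g x))).snd)
      ≤ bf ^ 2 := by
  have h := (S.het_f x).2
  rw [(hasGradientAt_meanGrad fun i => S.f_grad i _).gradY_eq] at h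
  simp only [(S.f_grad _ _).gradY_eq] at h
  exact h

lemma het_snd_g (x : Vec n) :
    meanSq (fun i => (nodeGrad g i (pt x (innerSol g x)) - meanGrad g (pt x (innerSol g x))).snd)
      ≤ bg ^ 2 := by
  have h := (S.het_g x).2
  rw [(hasGradientAt_meanGrad fun i => S.g_grad i _).gradY_eq] at h
  simp only [(S.g_grad _ _).gradY_eq] at h
  exact h

lemma penalty_node_lip (hlam : 1 ≤ lam) (i : Fin m) (p q : WithLp 2 (Vec n × Vec r)) :
    ‖(nodeGrad f i p + lam • nodeGrad g i p) - (nodeGrad f i q + lam • nodeGrad g i q)‖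
      ≤ 2 * lam * L * ‖p - q‖ := by
  rw [add_sub_add_comm, ← smul_sub]
  refine (norm_add_le _ _).trans ?_
  rw [norm_smul, Real.norm_of_nonneg (by linarith)]
  have h1 := S.f_lip i p q
  have h2 := mul_le_mul_of_nonneg_left (S.g_lip i p q) (by linarith : 0 ≤ lam)
  have h3 : 0 ≤ L * ‖p - q‖ := mul_nonneg S.data.L_pos.le (norm_nonneg _)
  nlinarith

/-- Compare with (x̄, y*(x̄)), the only kind of point where heterogeneity is controlled, and use
Lipschitz continuity for the displacement. -/
lemma consensusError_dirZ_le : consensusError (dirZ g s) ≤ 2 * bg ^ 2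
    + 2 * L ^ 2 * (consensusError s.x + consensusError s.z
      + ‖nodeAvg s.z - innerSol g (nodeAvg s.x)‖ ^ 2) := by
  have hm := S.net.node_pos
  set p := pt (nodeAvg s.x) (innerSol g (nodeAvg s.x)) with hp
  refine (consensusError_le_meanSq_sub hm _ (meanGrad g p).snd).trans ?_
  have e : (fun i => dirZ g s i - (meanGrad g p).snd)
      = fun i => (nodeGrad g i (pt (s.x i) (s.z i)) - nodeGrad g i p).snd
        + (nodeGrad g i p - meanGrad g p).snd := by
    funext i
    rw [dirZ, WithLp.sub_snd, WithLp.sub_snd]; abel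
  rw [e]
  refine (meanSq_add_le_two _ _).trans ?_
  have h1 := S.het_snd_g (nodeAvg s.x)
  have h2 := (meanSq_snd_le fun i => nodeGrad g i (pt (s.x i) (s.z i)) - nodeGrad g i p).trans
    (meanSq_le_of_norm_le fun i => S.g_lip i _ _)
  rw [hp, meanSq_pt_sub hm] at h2
  linarith

/-- ȳ tracks the penalized solution, but heterogeneity is assumed at y*; switching costs O(κ²/λ²),
which stays bounded in λ after multiplication by λ². -/
lemma norm_avg_sub_innerSol_sq_le {yl : Vec n → Vec r} (hlam : 1 ≤ lam) (hlam2 : 2 * (L / μ) ≤ lam)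
    (hyl : ∀ x, (meanGrad f (pt x (yl x)) + lam • meanGrad g (pt x (yl x))).snd = 0) :
    ‖nodeAvg s.y - innerSol g (nodeAvg s.x)‖ ^ 2
      ≤ 2 * ‖nodeAvg s.y - yl (nodeAvg s.x)‖ ^ 2 + 8 * (L / μ) ^ 2 / lam ^ 2 := by
  have h1 := norm_add_sq_le_two (nodeAvg s.y - yl (nodeAvg s.x))
    (yl (nodeAvg s.x) - innerSol g (nodeAvg s.x))
  rw [sub_add_sub_cancel] at h1
  have h2 := pow_le_pow_left₀ (norm_nonneg _)
    (S.data.norm_penaltyZero_sub_le S.ys_zero S.f_bound hlam2 hlam (hyl (nodeAvg s.x))) 2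
  have e : (2 * (L / μ) / lam) ^ 2 = 4 * (L / μ) ^ 2 / lam ^ 2 := by ring
  rw [e] at h2
  have e2 : 8 * (L / μ) ^ 2 / lam ^ 2 = 2 * (4 * (L / μ) ^ 2 / lam ^ 2) := by ring
  rw [e2]
  linarith

lemma consensusError_dirY_le {yl : Vec n → Vec r} (hlam : 1 ≤ lam) (hlam2 : 2 * (L / μ) ≤ lam)
    (hyl : ∀ x, (meanGrad f (pt x (yl x)) + lam • meanGrad g (pt x (yl x))).snd = 0) :
    consensusError (dirY f g lam s) ≤ 3 * bf ^ 2 + 3 * lam ^ 2 * bg ^ 2 + 96 * L ^ 2 * (L / μ) ^ 2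
      + 24 * lam ^ 2 * L ^ 2 * totalErr g yl s := by
  have hm := S.net.node_pos
  have hlam0 : 0 < lam := by linarith
  set p := pt (nodeAvg s.x) (innerSol g (nodeAvg s.x)) with hp
  refine (consensusError_le_meanSq_sub hm _ (meanGrad f p + lam • meanGrad g p).snd).trans ?_
  have e : (fun i => dirY f g lam s i - (meanGrad f p + lam • meanGrad g p).snd)
      = fun i => ((nodeGrad f i (pt (s.x i) (s.y i)) + lam • nodeGrad g i (pt (s.x i) (s.y i)))
          - (nodeGrad f i p + lam • nodeGrad g i p)).snd
        + (nodeGrad f i p - meanGrad f p).snd + lam • (nodeGrad g i p - meanGrad g p).snd := by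
    funext i
    simp only [dirY, WithLp.sub_snd, WithLp.add_snd, WithLp.smul_snd]
    module
  rw [e]
  refine (meanSq_add_le_three _ _ _).trans ?_
  rw [meanSq_smul]
  have h1 := mul_le_mul_of_nonneg_left (S.het_snd_g (nodeAvg s.x)) (sq_nonneg lam)
  have h3 := S.het_snd_f (nodeAvg s.x)
  have h2 := (meanSq_snd_le fun i => (nodeGrad f i (pt (s.x i) (s.y i))
    + lam • nodeGrad g i (pt (s.x i) (s.y i))) - (nodeGrad f i p + lam • nodeGrad g i p)).trans
    (meanSq_le_of_norm_le fun i => S.penalty_node_lip hlam i _ _)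
  rw [hp, meanSq_pt_sub hm] at h2
  have h4 := S.norm_avg_sub_innerSol_sq_le s hlam hlam2 hyl
  have h5 : consensusError s.x + consensusError s.y
      + ‖nodeAvg s.y - innerSol g (nodeAvg s.x)‖ ^ 2
      ≤ 2 * totalErr g yl s + 8 * (L / μ) ^ 2 / lam ^ 2 := by
    unfold totalErr
    linarith [consensusError_nonneg s.x, consensusError_nonneg s.y, consensusError_nonneg s.z,
      sq_nonneg ‖nodeAvg s.z - innerSol g (nodeAvg s.x)‖]
  have h6 := h2.trans (mul_le_mul_of_nonneg_left h5 (sq_nonneg _))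
  have e3 : (2 * lam * L) ^ 2 * (2 * totalErr g yl s + 8 * (L / μ) ^ 2 / lam ^ 2)
      = 8 * lam ^ 2 * L ^ 2 * totalErr g yl s + 32 * L ^ 2 * (L / μ) ^ 2 := by
    field_simp; ring
  rw [e3] at h6
  linarith

/-- The λ-part is a difference of gradients of the same gᵢ at yᵢ and zᵢ. It is controlled by ‖yᵢ −
zᵢ‖, so no heterogeneity of g enters. -/
lemma consensusError_dirX_le {yl : Vec n → Vec r} (hlam : 1 ≤ lam) (hlam2 : 2 * (L / μ) ≤ lam)
    (hyl : ∀ x, (meanGrad f (pt x (yl x)) + lam • meanGrad g (pt x (yl x))).snd = 0) :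
    consensusError (dirX f g lam s) ≤ 3 * bf ^ 2 + 72 * L ^ 2 * (L / μ) ^ 2
      + 18 * lam ^ 2 * L ^ 2 * totalErr g yl s := by
  have hm := S.net.node_pos
  have hlam0 : 0 < lam := by linarith
  set ys := innerSol g (nodeAvg s.x) with hys
  set p := pt (nodeAvg s.x) ys with hp
  refine (consensusError_le_meanSq_sub hm _ (meanGrad f p).fst).trans ?_
  have e : (fun i => dirX f g lam s i - (meanGrad f p).fst)
      = fun i => (nodeGrad f i (pt (s.x i) (s.y i)) - nodeGrad f i p).fst
        + (nodeGrad f i p - meanGrad f p).fst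
        + lam • (nodeGrad g i (pt (s.x i) (s.y i)) - nodeGrad g i (pt (s.x i) (s.z i))).fst := by
    funext i
    simp only [dirX, WithLp.sub_fst, WithLp.add_fst, WithLp.smul_fst]
    module
  rw [e]
  refine (meanSq_add_le_three _ _ _).trans ?_
  rw [meanSq_smul]
  have h3 := S.het_fst_f (nodeAvg s.x)
  have h2 := (meanSq_fst_le fun i => nodeGrad f i (pt (s.x i) (s.y i)) - nodeGrad f i p).trans
    (meanSq_le_of_norm_le fun i => S.f_lip i _ _)
  rw [hp, meanSq_pt_sub hm] at h2
  have h1 := (meanSq_fst_le fun i => nodeGrad g i (pt (s.x i) (s.y i))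
    - nodeGrad g i (pt (s.x i) (s.z i))).trans
    (meanSq_le_of_norm_le (w := fun i => (s.y i - ys) - (s.z i - ys)) (c := L) fun i => by
      have := S.g_lip i (pt (s.x i) (s.y i)) (pt (s.x i) (s.z i))
      rwa [norm_pt_sub_left, ← sub_sub_sub_cancel_right _ _ ys] at this)
  have h7 := meanSq_sub_le_two (fun i => s.y i - ys) (fun i => s.z i - ys)
  rw [meanSq_sub_const hm, meanSq_sub_const hm] at h7
  have h4 := S.norm_avg_sub_innerSol_sq_le s hlam hlam2 hyl
  rw [← hys] at h4
  have h8 := h1.trans (mul_le_mul_of_nonneg_left h7 (sq_nonneg L))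
  have h9 := mul_le_mul_of_nonneg_left h8 (sq_nonneg lam)
  have hl1 : 1 ≤ lam ^ 2 := one_le_pow₀ hlam
  have hnn : 0 ≤ L ^ 2 * (consensusError s.x + consensusError s.y + ‖nodeAvg s.y - ys‖ ^ 2) :=
    mul_nonneg (sq_nonneg _) (add_nonneg (add_nonneg (consensusError_nonneg _)
      (consensusError_nonneg _)) (sq_nonneg _))
  have h10 := h2.trans (le_mul_of_one_le_left hnn hl1)
  have h5 : (consensusError s.x + consensusError s.y + ‖nodeAvg s.y - ys‖ ^ 2)
      + (2 * (consensusError s.y + ‖nodeAvg s.y - ys‖ ^ 2)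
        + 2 * (consensusError s.z + ‖nodeAvg s.z - ys‖ ^ 2))
      ≤ 6 * totalErr g yl s + 24 * (L / μ) ^ 2 / lam ^ 2 := by
    have e2 : 24 * (L / μ) ^ 2 / lam ^ 2 = 3 * (8 * (L / μ) ^ 2 / lam ^ 2) := by ring
    rw [e2]
    unfold totalErr
    linarith [consensusError_nonneg s.x, consensusError_nonneg s.y, consensusError_nonneg s.z,
      sq_nonneg ‖nodeAvg s.z - ys‖]
  have h6 := mul_le_mul_of_nonneg_left h5 (by positivity : 0 ≤ 3 * (lam ^ 2 * L ^ 2))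
  have e3 : 3 * (lam ^ 2 * L ^ 2) * (6 * totalErr g yl s + 24 * (L / μ) ^ 2 / lam ^ 2)
      = 18 * lam ^ 2 * L ^ 2 * totalErr g yl s + 72 * L ^ 2 * (L / μ) ^ 2 := by
    field_simp; ring
  rw [e3] at h6
  linarith

/-- The reference is the exact penalty gradient at x̄. Node by node the same function is compared at
two points, so averaging leaves only tracking and consensus errors. -/
lemma norm_avg_dirX_sub_sq_le {yl : Vec n → Vec r} (hlam : 1 ≤ lam) :
    ‖nodeAvg (dirX f g lam s) - ((meanGrad f (pt (nodeAvg s.x) (yl (nodeAvg s.x)))).fst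
      + lam • ((meanGrad g (pt (nodeAvg s.x) (yl (nodeAvg s.x)))).fst
        - (meanGrad g (pt (nodeAvg s.x) (innerSol g (nodeAvg s.x)))).fst))‖ ^ 2
      ≤ 10 * lam ^ 2 * L ^ 2 * totalErr g yl s := by
  have hm := S.net.node_pos
  have hlam0 : 0 < lam := by linarith
  set p := pt (nodeAvg s.x) (innerSol g (nodeAvg s.x)) with hp
  set pl := pt (nodeAvg s.x) (yl (nodeAvg s.x)) with hpl
  have e : nodeAvg (dirX f g lam s) - ((meanGrad f pl).fst
      + lam • ((meanGrad g pl).fst - (meanGrad g p).fst))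
      = nodeAvg fun i => ((nodeGrad f i (pt (s.x i) (s.y i))
          + lam • nodeGrad g i (pt (s.x i) (s.y i)))
          - (nodeGrad f i pl + lam • nodeGrad g i pl)).fst
        - lam • (nodeGrad g i (pt (s.x i) (s.z i)) - nodeGrad g i p).fst := by
    rw [fst_meanGrad, fst_meanGrad, fst_meanGrad, ← nodeAvg_sub, ← nodeAvg_smul, ← nodeAvg_add,
      ← nodeAvg_sub]
    congr 1
    funext i
    simp only [dirX, WithLp.sub_fst, WithLp.add_fst, WithLp.smul_fst]
    module
  rw [e]
  refine (norm_nodeAvg_sq_le hm _).trans ((meanSq_sub_le_two _ _).trans ?_)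
  rw [meanSq_smul]
  have h1 := (meanSq_fst_le fun i => (nodeGrad f i (pt (s.x i) (s.y i))
    + lam • nodeGrad g i (pt (s.x i) (s.y i))) - (nodeGrad f i pl + lam • nodeGrad g i pl)).trans
    (meanSq_le_of_norm_le fun i => S.penalty_node_lip hlam i _ _)
  have h2 := (meanSq_fst_le fun i => nodeGrad g i (pt (s.x i) (s.z i)) - nodeGrad g i p).trans
    (meanSq_le_of_norm_le fun i => S.g_lip i _ _)
  rw [hpl, meanSq_pt_sub hm] at h1
  rw [hp, meanSq_pt_sub hm] at h2
  have h3 := mul_le_mul_of_nonneg_left h2 (sq_nonneg lam)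
  have h4 : 4 * (consensusError s.x + consensusError s.y + ‖nodeAvg s.y - yl (nodeAvg s.x)‖ ^ 2)
      + (consensusError s.x + consensusError s.z
        + ‖nodeAvg s.z - innerSol g (nodeAvg s.x)‖ ^ 2) ≤ 5 * totalErr g yl s := by
    unfold totalErr
    linarith [consensusError_nonneg s.x, consensusError_nonneg s.y, consensusError_nonneg s.z,
      sq_nonneg ‖nodeAvg s.z - innerSol g (nodeAvg s.x)‖,
      sq_nonneg ‖nodeAvg s.y - yl (nodeAvg s.x)‖]
  have h5 := mul_le_mul_of_nonneg_left h4 (by positivity : 0 ≤ 2 * (lam ^ 2 * L ^ 2))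
  linarith

/-- One-step recursion of the distance of `z̄` to the exact inner solution. -/
lemma err_z_step_le {α β γ : ℝ} (hγ : 0 < γ) (hγL : γ * L ^ 2 ≤ μ) (hγμ : γ * μ ≤ 1) :
    ‖nodeAvg (aheadStep W f g α β γ lam s).z
        - innerSol g (nodeAvg (aheadStep W f g α β γ lam s).x)‖ ^ 2
      ≤ (1 - γ * μ / 2) * ‖nodeAvg s.z - innerSol g (nodeAvg s.x)‖ ^ 2
        + 6 / (γ * μ) * (γ ^ 2 * (L ^ 2 * (consensusError s.x + consensusError s.z))
          + (L / μ) ^ 2 * α ^ 2 * ‖nodeAvg (dirX f g lam s)‖ ^ 2) := by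
  have hm := S.net.node_pos
  have hμ := S.data.μ_pos
  rw [S.aheadStep_z, S.aheadStep_x, S.nodeAvg_mix_sub, S.nodeAvg_mix_sub]
  set x := nodeAvg s.x with hx
  set z := nodeAvg s.z with hz
  set u := nodeAvg (dirX f g lam s) with hu
  -- Mixing preserves averages, so z̄ makes an exact gradient step for the mean function at (x̄,
  -- z̄), perturbed by p, which is due to consensus errors alone.
  have h := (S.data.mono x).tracking (S.data.snd_lip_right x) hμ hγ hγL hγμ
    (v := z) (v₀ := innerSol g x) (v₁ := innerSol g (x - α • u))
    (p := nodeAvg (dirZ g s) - (meanGrad g (pt x z)).snd) (S.ys_zero x)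
  rw [add_sub_cancel] at h
  have h1 : ‖nodeAvg (dirZ g s) - (meanGrad g (pt x z)).snd‖ ^ 2
      ≤ L ^ 2 * (consensusError s.x + consensusError s.z) := by
    rw [snd_meanGrad, ← nodeAvg_sub]
    refine (norm_nodeAvg_sq_le hm _).trans ?_
    have h2 := (meanSq_snd_le fun i => nodeGrad g i (pt (s.x i) (s.z i))
      - nodeGrad g i (pt x z)).trans (meanSq_le_of_norm_le fun i => S.g_lip i _ _)
    rw [hx, meanSq_pt_sub hm, ← hz, sub_self, norm_zero] at h2
    norm_num at h2
    exact h2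
  have h3 : ‖innerSol g (x - α • u) - innerSol g x‖ ^ 2 ≤ (L / μ) ^ 2 * α ^ 2 * ‖u‖ ^ 2 := by
    have h4 := pow_le_pow_left₀ (norm_nonneg _)
      (S.data.innerZero_lip S.ys_zero (x - α • u) x) 2
    rw [sub_sub_cancel_left, norm_neg, norm_smul, mul_pow, mul_pow, Real.norm_eq_abs,
      sq_abs, ← mul_assoc] at h4
    exact h4
  refine h.trans (add_le_add le_rfl ?_)
  exact mul_le_mul_of_nonneg_left
    (add_le_add (mul_le_mul_of_nonneg_left h1 (sq_nonneg _)) h3) (by positivity)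

/-- One-step recursion of the distance of `ȳ` to the penalized inner solution. -/
lemma err_y_step_le {yl : Vec n → Vec r} (hlam : 1 ≤ lam) (hlam2 : 2 * (L / μ) ≤ lam)
    (hyl : ∀ x, (meanGrad f (pt x (yl x)) + lam • meanGrad g (pt x (yl x))).snd = 0)
    {α β γ : ℝ} (hβ : 0 < β) (hβL : β * (2 * lam * L) ^ 2 ≤ lam * μ / 2)
    (hβμ : β * (lam * μ / 2) ≤ 1) :
    ‖nodeAvg (aheadStep W f g α β γ lam s).y
        - yl (nodeAvg (aheadStep W f g α β γ lam s).x)‖ ^ 2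
      ≤ (1 - β * (lam * μ / 2) / 2) * ‖nodeAvg s.y - yl (nodeAvg s.x)‖ ^ 2
        + 6 / (β * (lam * μ / 2)) * (β ^ 2 * ((2 * lam * L) ^ 2
            * (consensusError s.x + consensusError s.y))
          + (4 * (L / μ)) ^ 2 * α ^ 2 * ‖nodeAvg (dirX f g lam s)‖ ^ 2) := by
  have hm := S.net.node_pos
  have hμ := S.data.μ_pos
  have hlam0 : 0 < lam := by linarith
  rw [S.aheadStep_y, S.aheadStep_x, S.nodeAvg_mix_sub, S.nodeAvg_mix_sub]
  set x := nodeAvg s.x with hx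
  set y := nodeAvg s.y with hy
  set u := nodeAvg (dirX f g lam s) with hu
  have h := (S.data.penalty_mono hlam2 x).tracking (S.data.penalty_lip_right hlam x)
    (by positivity) hβ hβL hβμ (v := y) (v₀ := yl x) (v₁ := yl (x - α • u))
    (p := nodeAvg (dirY f g lam s) - (meanGrad f (pt x y) + lam • meanGrad g (pt x y)).snd)
    (hyl x)
  rw [add_sub_cancel] at h
  have h1 : ‖nodeAvg (dirY f g lam s) - (meanGrad f (pt x y) + lam • meanGrad g (pt x y)).snd‖ ^ 2
      ≤ (2 * lam * L) ^ 2 * (consensusError s.x + consensusError s.y) := by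
    rw [WithLp.add_snd, WithLp.smul_snd, snd_meanGrad, snd_meanGrad, ← nodeAvg_smul,
      ← nodeAvg_add, ← nodeAvg_sub]
    refine (norm_nodeAvg_sq_le hm _).trans ?_
    have h2 := (meanSq_snd_le fun i => (nodeGrad f i (pt (s.x i) (s.y i))
      + lam • nodeGrad g i (pt (s.x i) (s.y i)))
      - (nodeGrad f i (pt x y) + lam • nodeGrad g i (pt x y))).trans
      (meanSq_le_of_norm_le fun i => S.penalty_node_lip hlam i _ _)
    rw [hx, meanSq_pt_sub hm, ← hy, sub_self, norm_zero, ← hx] at h2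
    rw [zero_pow two_ne_zero, add_zero] at h2
    exact h2
  have h3 : ‖yl (x - α • u) - yl x‖ ^ 2 ≤ (4 * (L / μ)) ^ 2 * α ^ 2 * ‖u‖ ^ 2 := by
    have h4 := pow_le_pow_left₀ (norm_nonneg _)
      (S.data.penaltyZero_lip hlam2 hlam hyl (x - α • u) x) 2
    rw [sub_sub_cancel_left, norm_neg, norm_smul, mul_pow, mul_pow ‖α‖, Real.norm_eq_abs,
      sq_abs, ← mul_assoc] at h4
    exact h4
  refine h.trans (add_le_add le_rfl ?_)
  exact mul_le_mul_of_nonneg_left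
    (add_le_add (mul_le_mul_of_nonneg_left h1 (sq_nonneg _)) h3) (by positivity)

end AheadSetting

/-- Combination of the summed recursions: the consensus and the tracking errors are eliminated. -/
lemma sum_bound_of_coupled {L κ A α β γ lam bias bf bg D Δ qy qz N Dx Dy Dz Ey Ez U P : ℝ}
    (hκ : 1 ≤ κ) (hU : 0 ≤ U)
    (hDx0 : 0 ≤ Dx) (hDy0 : 0 ≤ Dy) (hDz0 : 0 ≤ Dz) (hEy0 : 0 ≤ Ey) (hEz0 : 0 ≤ Ez)
    (hDx : Dx ≤ 2 * A * D + 6 * A ^ 2 * α ^ 2 * (N * (3 * bf ^ 2 + 72 * L ^ 2 * κ ^ 2)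
      + 18 * lam ^ 2 * L ^ 2 * (Dx + Dy + Dz + Ey + Ez)))
    (hDy : Dy ≤ 2 * A * D + 6 * A ^ 2 * β ^ 2 * (N * (3 * bf ^ 2 + 3 * lam ^ 2 * bg ^ 2
      + 96 * L ^ 2 * κ ^ 2) + 24 * lam ^ 2 * L ^ 2 * (Dx + Dy + Dz + Ey + Ez)))
    (hDz : Dz ≤ 2 * A * D + 6 * A ^ 2 * γ ^ 2 * (N * (2 * bg ^ 2)
      + 2 * L ^ 2 * (Dx + Dy + Dz + Ey + Ez)))
    (hEy : Ey ≤ (4 * D + 4) / qy + 192 * κ ^ 2 * (Dx + Dy) + 192 * κ ^ 2 * α ^ 2 / qy ^ 2 * U)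
    (hEz : Ez ≤ 2 * D / qz + 12 * κ ^ 2 * (Dx + Dz) + 12 * κ ^ 2 * α ^ 2 / qz ^ 2 * U)
    (hP : P + U / 2 ≤ 2 * Δ / α + 2 * N * bias ^ 2
      + 20 * lam ^ 2 * L ^ 2 * (Dx + Dy + Dz + Ey + Ez))
    (hc1 : 205 * κ ^ 2 * (6 * A ^ 2 * (18 * α ^ 2 * lam ^ 2 * L ^ 2
      + 24 * β ^ 2 * lam ^ 2 * L ^ 2 + 2 * γ ^ 2 * L ^ 2)) ≤ 1 / 2)
    (hc2 : 40 * lam ^ 2 * L ^ 2 * (192 * κ ^ 2 * α ^ 2 / qy ^ 2 + 12 * κ ^ 2 * α ^ 2 / qz ^ 2)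
      ≤ 1 / 2) :
    P ≤ 2 * Δ / α + 2 * N * bias ^ 2 + 20 * lam ^ 2 * L ^ 2 * (410 * κ ^ 2 * (6 * A * D
      + 6 * A ^ 2 * N * (α ^ 2 * (3 * bf ^ 2 + 72 * L ^ 2 * κ ^ 2)
        + β ^ 2 * (3 * bf ^ 2 + 3 * lam ^ 2 * bg ^ 2 + 96 * L ^ 2 * κ ^ 2) + γ ^ 2 * (2 * bg ^ 2)))
      + 2 * ((4 * D + 4) / qy + 2 * D / qz)) := by
  set T := Dx + Dy + Dz + Ey + Ez with hT
  set ε := 6 * A ^ 2 * (18 * α ^ 2 * lam ^ 2 * L ^ 2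
      + 24 * β ^ 2 * lam ^ 2 * L ^ 2 + 2 * γ ^ 2 * L ^ 2) with hε
  set F := 6 * A * D + 6 * A ^ 2 * N * (α ^ 2 * (3 * bf ^ 2 + 72 * L ^ 2 * κ ^ 2)
        + β ^ 2 * (3 * bf ^ 2 + 3 * lam ^ 2 * bg ^ 2 + 96 * L ^ 2 * κ ^ 2)
        + γ ^ 2 * (2 * bg ^ 2)) with hF
  set I := (4 * D + 4) / qy + 2 * D / qz with hI
  set η := 192 * κ ^ 2 * α ^ 2 / qy ^ 2 + 12 * κ ^ 2 * α ^ 2 / qz ^ 2 with hη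
  have hT0 : 0 ≤ T := by positivity
  have hcons : Dx + Dy + Dz ≤ F + ε * T := by
    rw [hF, hε]; linarith
  have hκ2 : 1 ≤ κ ^ 2 := one_le_pow₀ hκ
  -- 204 = 192 + 12; adding the consensus errors themselves, with κ ≥ 1, gives the 205 of `hc1`.
  have hE : Ey + Ez ≤ I + 204 * κ ^ 2 * (Dx + Dy + Dz) + η * U := by
    have h1 : 0 ≤ κ ^ 2 * Dy := by positivity
    have h2 : 0 ≤ κ ^ 2 * Dz := by positivity
    rw [hI, hη]; linarith
  have hT1 : T ≤ I + 205 * κ ^ 2 * (Dx + Dy + Dz) + η * U := by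
    have h3 : Dx + Dy + Dz ≤ κ ^ 2 * (Dx + Dy + Dz) :=
      le_mul_of_one_le_left (by positivity) hκ2
    rw [hT]; linarith
  -- Closing the loop: by `hc1` the feedback of T through the consensus errors is at most T/2.
  have hT2 : T ≤ I + 205 * κ ^ 2 * F + 1 / 2 * T + η * U := by
    have h4 := mul_le_mul_of_nonneg_left hcons (by positivity : 0 ≤ 205 * κ ^ 2)
    have h5 := mul_le_mul_of_nonneg_right hc1 hT0
    linarith
  have hT3 : T ≤ 410 * κ ^ 2 * F + 2 * I + 2 * (η * U) := by linarith
  have h6 := mul_le_mul_of_nonneg_left hT3 (by positivity : 0 ≤ 20 * lam ^ 2 * L ^ 2)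
  -- By `hc2` the drift contributes at most U/2 to the descent bound, exactly what its left-hand
  -- side offers.
  have h7 := mul_le_mul_of_nonneg_right hc2 hU
  linarith

/-- Sums of a recursion with rate `1 - q`. -/
lemma sum_le_div_of_contractive {e c : ℕ → ℝ} {q e₀ : ℝ} (hq : 0 < q) (he : ∀ k, 0 ≤ e k)
    (h : ∀ k, e (k + 1) ≤ (1 - q) * e k + c k) (h0 : e 0 ≤ e₀) (N : ℕ) :
    ∑ k ∈ range N, e k ≤ e₀ / q + (∑ k ∈ range N, c k) / q := by
  have h1 := sum_le_of_contractive he h N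
  rw [← add_div, le_div_iff₀ hq, mul_comm]
  linarith

/-! ### Summation along the iterations -/

namespace AheadSetting

variable {m n r : ℕ} {L M μ bf bg : ℝ} {G : SimpleGraph (Fin m)}
    {W : Matrix (Fin m) (Fin m) ℝ} {f g : Fin m → Vec n → Vec r → ℝ}
    (S : AheadSetting L M μ bf bg G W f g)

include S

/-- Summed consensus errors of a sequence of mixing steps. -/
lemma sum_consensusError_le {k : ℕ} {v d : ℕ → Fin m → Vec k} {s D c₀ c₁ : ℝ} {T : ℕ → ℝ}
    (hv : ∀ j, v (j + 1) = fun i => (∑ i', W i i' • v j i') - s • d j i)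
    (hd : ∀ j, consensusError (d j) ≤ c₀ + c₁ * T j) (h0 : consensusError (v 0) ≤ D) (K : ℕ) :
    ∑ j ∈ range K, consensusError (v j) ≤ 2 * (1 / (1 - mixingRate W)) * D
      + 6 * (1 / (1 - mixingRate W)) ^ 2 * s ^ 2 * (K * c₀ + c₁ * ∑ j ∈ range K, T j) := by
  set ρ := mixingRate W with hρ
  have hρ1 : 0 < 1 - ρ := sub_pos.2 S.net.mixingRate_lt_one
  have h := sum_le_div_of_contractive (e := fun j => consensusError (v j))
    (c := fun j => 3 / (1 - ρ) * (s ^ 2 * (c₀ + c₁ * T j))) (q := (1 - ρ) / 2) (e₀ := D)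
    (by positivity) (fun j => consensusError_nonneg _) (fun j => by
      have h1 := S.net.consensusError_step_le (v j) (d j) s
      rw [← hv j, ← hρ] at h1
      have h2 : 3 / (1 - ρ) * (s ^ 2 * consensusError (d j))
          ≤ 3 / (1 - ρ) * (s ^ 2 * (c₀ + c₁ * T j)) :=
        mul_le_mul_of_nonneg_left (mul_le_mul_of_nonneg_left (hd j) (sq_nonneg s))
          (by positivity)
      have e : 1 - (1 - ρ) / 2 = (1 + ρ) / 2 := by ring
      simp only [e]
      linarith) h0 K
  refine h.trans (le_of_eq ?_)
  simp only [← mul_sum, sum_add_distrib, sum_const, card_range, nsmul_eq_mul]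
  field_simp
  ring

/-- The averaged squared hypergradient along `K` iterations of AHEAD, before the orders of the
parameters are inserted. -/
theorem sum_norm_gradient_sq_le (hr : 0 < r) {s₀ : AheadState m (Vec n) (Vec r)} {Δ D α β γ lam : ℝ}
    (h0 : InitialBound f g s₀ Δ D) (hlam : 1 ≤ lam) (hlam2 : 2 * (L / μ) ≤ lam)
    (hα : 0 < α) (hβ : 0 < β) (hγ : 0 < γ)
    (hαB : α * ((L + L / μ * M) * (1 + (L / μ) ^ 2)) ≤ 1 / 4)
    (hβL : β * (2 * lam * L) ^ 2 ≤ lam * μ / 2) (hβμ : β * (lam * μ / 2) ≤ 1)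
    (hγL : γ * L ^ 2 ≤ μ) (hγμ : γ * μ ≤ 1)
    (hc1 : 205 * (L / μ) ^ 2 * (6 * (1 / (1 - mixingRate W)) ^ 2 * (18 * α ^ 2 * lam ^ 2 * L ^ 2
      + 24 * β ^ 2 * lam ^ 2 * L ^ 2 + 2 * γ ^ 2 * L ^ 2)) ≤ 1 / 2)
    (hc2 : 40 * lam ^ 2 * L ^ 2 * (192 * (L / μ) ^ 2 * α ^ 2 / (β * (lam * μ / 2)) ^ 2
      + 12 * (L / μ) ^ 2 * α ^ 2 / (γ * μ) ^ 2) ≤ 1 / 2) (K : ℕ) :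
    ∑ k ∈ range K, ‖gradient (bilevelObj f g) (nodeAvg (ahead W f g α β γ lam s₀ k).x)‖ ^ 2
      ≤ 2 * Δ / α
        + 2 * K * ((1 + L / μ) * (2 * L * (L / μ) / lam + 4 * M * (L / μ) ^ 2 / lam)) ^ 2
        + 20 * lam ^ 2 * L ^ 2 * (410 * (L / μ) ^ 2 * (6 * (1 / (1 - mixingRate W)) * D
          + 6 * (1 / (1 - mixingRate W)) ^ 2 * K * (α ^ 2 * (3 * bf ^ 2 + 72 * L ^ 2 * (L / μ) ^ 2)
            + β ^ 2 * (3 * bf ^ 2 + 3 * lam ^ 2 * bg ^ 2 + 96 * L ^ 2 * (L / μ) ^ 2)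
            + γ ^ 2 * (2 * bg ^ 2)))
          + 2 * ((4 * D + 4) / (β * (lam * μ / 2)) + 2 * D / (γ * μ))) := by
  have hμ := S.data.μ_pos
  have hL := S.data.L_pos
  have hlam0 : 0 < lam := by linarith
  have : Nonempty (Fin r) := ⟨⟨0, hr⟩⟩
  have hκ : 1 ≤ L / μ := by
    rw [le_div_iff₀ hμ, one_mul]; exact S.data.mu_le inferInstance
  have hρ1 : 0 < 1 - mixingRate W := sub_pos.2 S.net.mixingRate_lt_one
  have hD : 0 ≤ D := (consensusError_nonneg _).trans h0.cons_x
  choose yl hyl using fun x => S.data.exists_penaltyZero hlam2 hlam x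
  obtain ⟨h, hquad, hbias⟩ := S.data.exists_hypergradient S.ys_zero S.f_bound
  have hgrad : gradient (bilevelObj f g) = h := funext fun x =>
    (hasGradientAt_of_quadratic_bound (Φ := bilevelObj f g) hquad x).gradient
  set bias := (1 + L / μ) * (2 * L * (L / μ) / lam + 4 * M * (L / μ) ^ 2 / lam) with hbias_def
  set st : ℕ → AheadState m (Vec n) (Vec r) := ahead W f g α β γ lam s₀ with hst
  have hstep : ∀ k, st (k + 1) = aheadStep W f g α β γ lam (st k) := fun k =>
    Function.iterate_succ_apply' _ _ _
  set u : ℕ → Vec n := fun k => nodeAvg (dirX f g lam (st k)) with hu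
  set T : ℕ → ℝ := fun k => totalErr g yl (st k) with hT
  have hst0 : st 0 = s₀ := rfl
  have hDx := S.sum_consensusError_le (v := fun k => (st k).x)
    (d := fun k => dirX f g lam (st k)) (s := α) (T := T)
    (fun k => by rw [hstep, S.aheadStep_x])
    (fun k => S.consensusError_dirX_le (st k) hlam hlam2 hyl) h0.cons_x K
  have hDy := S.sum_consensusError_le (v := fun k => (st k).y)
    (d := fun k => dirY f g lam (st k)) (s := β) (T := T)
    (fun k => by rw [hstep, S.aheadStep_y])
    (fun k => S.consensusError_dirY_le (st k) hlam hlam2 hyl) h0.cons_y K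
  have hDz := S.sum_consensusError_le (v := fun k => (st k).z)
    (d := fun k => dirZ g (st k)) (s := γ) (T := T) (c₀ := 2 * bg ^ 2) (c₁ := 2 * L ^ 2)
    (fun k => by rw [hstep, S.aheadStep_z])
    (fun k => (S.consensusError_dirZ_le (st k)).trans (by
      simp only [hT, totalErr]
      have h1 : consensusError (st k).x + consensusError (st k).z
          + ‖nodeAvg (st k).z - innerSol g (nodeAvg (st k).x)‖ ^ 2
          ≤ consensusError (st k).x + consensusError (st k).y + consensusError (st k).z
            + ‖nodeAvg (st k).y - yl (nodeAvg (st k).x)‖ ^ 2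
            + ‖nodeAvg (st k).z - innerSol g (nodeAvg (st k).x)‖ ^ 2 := by
        linarith [consensusError_nonneg (st k).y, sq_nonneg ‖nodeAvg (st k).y
          - yl (nodeAvg (st k).x)‖]
      linarith [mul_le_mul_of_nonneg_left h1 (by positivity : 0 ≤ 2 * L ^ 2)])) h0.cons_z K
  have hqy : 0 < β * (lam * μ / 2) := by positivity
  have hqz : 0 < γ * μ := by positivity
  -- The initial value 2D + 2 comes from switching y* to y_λ, at distance at most 1 since 2κ ≤ λ.
  -- With rate q/2, q = βλμ/2, the consensus coefficient is 12β²(2λL)²/q² = 192κ², free of β and λ.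
  have hEy := sum_le_div_of_contractive
    (e := fun k => ‖nodeAvg (st k).y - yl (nodeAvg (st k).x)‖ ^ 2) (e₀ := 2 * D + 2)
    (c := fun k => 6 / (β * (lam * μ / 2)) * (β ^ 2 * ((2 * lam * L) ^ 2
            * (consensusError (st k).x + consensusError (st k).y))
          + (4 * (L / μ)) ^ 2 * α ^ 2 * ‖u k‖ ^ 2)) (q := β * (lam * μ / 2) / 2)
    (by positivity) (fun k => sq_nonneg _) (fun k => by
      simp only [hstep]
      exact S.err_y_step_le (st k) hlam hlam2 hyl hβ hβL hβμ) (by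
      rw [hst0]
      have h1 := norm_add_sq_le_two (nodeAvg s₀.y - innerSol g (nodeAvg s₀.x))
        (innerSol g (nodeAvg s₀.x) - yl (nodeAvg s₀.x))
      rw [sub_add_sub_cancel] at h1
      have h2 := S.data.norm_penaltyZero_sub_le S.ys_zero S.f_bound hlam2 hlam
        (hyl (nodeAvg s₀.x))
      rw [norm_sub_rev] at h2
      have h3 : 2 * (L / μ) / lam ≤ 1 := (div_le_one hlam0).2 hlam2
      have h4 := pow_le_one₀ (n := 2) (norm_nonneg _) (h2.trans h3)
      linarith [h0.err_y]) K
  have hEz := sum_le_div_of_contractive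
    (e := fun k => ‖nodeAvg (st k).z - innerSol g (nodeAvg (st k).x)‖ ^ 2) (e₀ := D)
    (c := fun k => 6 / (γ * μ) * (γ ^ 2 * (L ^ 2 * (consensusError (st k).x
        + consensusError (st k).z)) + (L / μ) ^ 2 * α ^ 2 * ‖u k‖ ^ 2)) (q := γ * μ / 2)
    (by positivity) (fun k => sq_nonneg _) (fun k => by
      simp only [hstep]
      exact S.err_z_step_le (st k) hγ hγL hγμ) h0.err_z K
  -- The descent inequality multiplied by 2/α; the differences of Φ telescope in the sum.
  have hdesc : ∀ k, ‖h (nodeAvg (st k).x)‖ ^ 2 + 1 / 2 * ‖u k‖ ^ 2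
      ≤ 2 / α * (bilevelObj f g (nodeAvg (st k).x) - bilevelObj f g (nodeAvg (st (k + 1)).x))
        + (2 * bias ^ 2 + 20 * lam ^ 2 * L ^ 2 * T k) := fun k => by
    have h1 := descent_of_quadratic_bound (Φ := bilevelObj f g) hquad hα hαB
      (nodeAvg (st k).x) (u k)
    have e1 : nodeAvg (st (k + 1)).x = nodeAvg (st k).x - α • u k := by
      rw [hstep, S.aheadStep_x, S.nodeAvg_mix_sub]
    rw [← e1] at h1
    have h2 := S.norm_avg_dirX_sub_sq_le (st k) (yl := yl) hlam
    have h3 := hbias lam hlam2 hlam (nodeAvg (st k).x) (yl (nodeAvg (st k).x)) (hyl _)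
    have h4 := pow_le_pow_left₀ (norm_nonneg _) h3 2
    have h5 : ‖h (nodeAvg (st k).x) - u k‖ ^ 2 ≤ 2 * bias ^ 2 + 20 * lam ^ 2 * L ^ 2 * T k := by
      rw [norm_sub_rev] at h2
      have h6 := norm_add_sq_le_two (h (nodeAvg (st k).x)
        - ((meanGrad f (pt (nodeAvg (st k).x) (yl (nodeAvg (st k).x)))).fst
      + lam • ((meanGrad g (pt (nodeAvg (st k).x) (yl (nodeAvg (st k).x)))).fst
        - (meanGrad g (pt (nodeAvg (st k).x) (innerSol g (nodeAvg (st k).x)))).fst)))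
        (((meanGrad f (pt (nodeAvg (st k).x) (yl (nodeAvg (st k).x)))).fst
      + lam • ((meanGrad g (pt (nodeAvg (st k).x) (yl (nodeAvg (st k).x)))).fst
        - (meanGrad g (pt (nodeAvg (st k).x) (innerSol g (nodeAvg (st k).x)))).fst)) - u k)
      rw [sub_add_sub_cancel] at h6
      linarith
    have h7 := mul_le_mul_of_nonneg_left h5 (by positivity : 0 ≤ α / 2)
    have h8 : α / 2 * (‖h (nodeAvg (st k).x)‖ ^ 2 + 1 / 2 * ‖u k‖ ^ 2)
        ≤ α / 2 * (2 / α * (bilevelObj f g (nodeAvg (st k).x)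
          - bilevelObj f g (nodeAvg (st (k + 1)).x))
          + (2 * bias ^ 2 + 20 * lam ^ 2 * L ^ 2 * T k)) := by
      have e2 : α / 2 * (2 / α * (bilevelObj f g (nodeAvg (st k).x)
          - bilevelObj f g (nodeAvg (st (k + 1)).x))) = bilevelObj f g (nodeAvg (st k).x)
          - bilevelObj f g (nodeAvg (st (k + 1)).x) := by field_simp
      rw [mul_add (α / 2) (2 / α * _), e2]
      linarith
    exact le_of_mul_le_mul_left h8 (by positivity)
  have hP := sum_le_sum fun k (_ : k ∈ range K) => hdesc k
  simp only [sum_add_distrib, ← mul_sum, sum_range_sub', sum_const, card_range,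
    nsmul_eq_mul] at hP
  rw [hst0] at hP
  have hgap := mul_le_mul_of_nonneg_left (h0.gap (nodeAvg (st K).x))
    (by positivity : 0 ≤ 2 / α)
  have hTsum : ∑ k ∈ range K, T k = ∑ k ∈ range K, consensusError (st k).x
      + ∑ k ∈ range K, consensusError (st k).y + ∑ k ∈ range K, consensusError (st k).z
      + ∑ k ∈ range K, ‖nodeAvg (st k).y - yl (nodeAvg (st k).x)‖ ^ 2
      + ∑ k ∈ range K, ‖nodeAvg (st k).z - innerSol g (nodeAvg (st k).x)‖ ^ 2 := by
    simp only [hT, totalErr, sum_add_distrib]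
  rw [hTsum] at hDx hDy hDz hP
  simp only [← mul_sum, sum_add_distrib] at hEy hEz
  rw [hgrad]
  have hsc : ∀ v : ℕ → Fin m → Vec n, 0 ≤ ∑ k ∈ range K, consensusError (v k) := fun v =>
    sum_nonneg fun k _ => consensusError_nonneg _
  have hsc' : ∀ v : ℕ → Fin m → Vec r, 0 ≤ ∑ k ∈ range K, consensusError (v k) := fun v =>
    sum_nonneg fun k _ => consensusError_nonneg _
  refine sum_bound_of_coupled (U := ∑ k ∈ range K, ‖u k‖ ^ 2) hκ
    (by positivity) (hsc fun k => (st k).x) (hsc' fun k => (st k).y)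
    (hsc' fun k => (st k).z) (by positivity) (by positivity) hDx hDy hDz
    (hEy.trans (le_of_eq ?_)) (hEz.trans (le_of_eq ?_)) ?_ hc1 hc2
  · field_simp
    ring
  · field_simp
    ring
  · have e : 2 / α * Δ = 2 * Δ / α := by ring
    rw [e] at hgap
    linarith
end AheadSetting

/-! ### Orders of the parameters in κ and t = K^(1/6) -/

section Rates

variable {L M κ t α β γ lam A D Δ bf bg a a' b b' c c' l l' α₀ β₀ γ₀ l₀ : ℝ}

set_option maxHeartbeats 2000000 in
/-- For parameters of the prescribed orders, the bound on the summed squared hypergradients divided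
by the number `t⁶` of iterations has the claimed order. -/
lemma rate_of_orders (hL : 0 < L) (hM : 0 ≤ M) (hκ : 1 ≤ κ) (ht : 1 ≤ t) (hA : 1 ≤ A)
    (hAt : A ^ 2 ≤ t) (hD : 0 ≤ D) (hΔ : 0 ≤ Δ) (ha : 0 < a) (hb : 0 < b) (hc : 0 < c) (hl : 0 < l)
    (hα : α = α₀ / (κ ^ 3 * t ^ 4)) (hβ : β = β₀ / (κ * t ^ 3)) (hγ : γ = γ₀ / t ^ 2)
    (hlam : lam = l₀ * (κ * t)) (haα : a ≤ α₀) (hα' : α₀ ≤ a') (hbβ : b ≤ β₀) (hβ' : β₀ ≤ b')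
    (hcγ : c ≤ γ₀) (hγ' : γ₀ ≤ c') (hll : l ≤ l₀) (hl' : l₀ ≤ l') :
    1 / t ^ 6 * (2 * Δ / α
        + 2 * t ^ 6 * ((1 + κ) * (2 * L * κ / lam + 4 * M * κ ^ 2 / lam)) ^ 2
        + 20 * lam ^ 2 * L ^ 2 * (410 * κ ^ 2 * (6 * A * D
          + 6 * A ^ 2 * t ^ 6 * (α ^ 2 * (3 * bf ^ 2 + 72 * L ^ 2 * κ ^ 2)
            + β ^ 2 * (3 * bf ^ 2 + 3 * lam ^ 2 * bg ^ 2 + 96 * L ^ 2 * κ ^ 2)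
            + γ ^ 2 * (2 * bg ^ 2)))
          + 2 * ((4 * D + 4) / (β * (lam * (L / κ) / 2)) + 2 * D / (γ * (L / κ)))))
      ≤ (2 * Δ / a + 2 * ((4 * L + 8 * M) / l) ^ 2 + 49200 * L ^ 2 * l' ^ 2 * D
          + 49200 * L ^ 2 * l' ^ 2 * (72 * L ^ 2 * a' ^ 2 + 96 * L ^ 2 * b' ^ 2)
          + 40 * L ^ 2 * l' ^ 2 * (2 * (4 * D + 4) / (b * l * L) + 2 * D / (c * L)))
          * (κ ^ 4 / t ^ 2)
        + A ^ 2 * (49200 * L ^ 2 * l' ^ 2 * (3 * a' ^ 2 + 3 * b' ^ 2) * (κ ^ 2 * bf ^ 2 / t ^ 4)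
          + 49200 * L ^ 2 * l' ^ 2 * (3 * b' ^ 2 * l' ^ 2 + 2 * c' ^ 2)
            * (κ ^ 4 * bg ^ 2 / t ^ 2)) := by
  have hκ0 : 0 < κ := by linarith
  have ht0 : 0 < t := by linarith
  have hA0 : 0 < A := by linarith
  have hα0 : 0 < α₀ := by linarith
  have hβ0 : 0 < β₀ := by linarith
  have hγ0 : 0 < γ₀ := by linarith
  have hl0 : 0 < l₀ := by linarith
  -- A stands for 1/(1−ρ). In the terms without b_f and b_g there are powers of t to spare, and A² ≤
  -- t removes the network constant there.
  have hA1 : A ≤ t := by nlinarith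
  have hp : ∀ i j : ℕ, i ≤ j → κ ^ i ≤ κ ^ j := fun i j h => pow_le_pow_right₀ hκ h
  have hq : ∀ i j : ℕ, i ≤ j → t ^ i ≤ t ^ j := fun i j h => pow_le_pow_right₀ ht h
  have h1 : 1 / t ^ 6 * (2 * Δ / α) ≤ 2 * Δ / a * (κ ^ 4 / t ^ 2) := by
    calc _ = 2 * Δ / α₀ * (κ ^ 3 / t ^ 2) := by rw [hα]; field_simp
      _ ≤ _ := by
        have := hp 3 4 (by norm_num)
        gcongr
  have h2 : 1 / t ^ 6 * (2 * t ^ 6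
      * ((1 + κ) * (2 * L * κ / lam + 4 * M * κ ^ 2 / lam)) ^ 2)
      ≤ 2 * ((4 * L + 8 * M) / l) ^ 2 * (κ ^ 4 / t ^ 2) := by
    have e : (1 + κ) * (2 * L * κ / lam + 4 * M * κ ^ 2 / lam)
        = (1 + κ) * (2 * L + 4 * M * κ) / (l₀ * t) := by
      rw [hlam]; field_simp
    have h3 : (1 + κ) * (2 * L + 4 * M * κ) ≤ κ ^ 2 * (4 * L + 8 * M) := by
      have h4 : (1 + κ) * (2 * L + 4 * M * κ) ≤ (2 * κ) * ((2 * L + 4 * M) * κ) := by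
        refine mul_le_mul (by linarith) ?_ (by positivity) (by positivity)
        nlinarith
      linarith
    have h5 : (1 + κ) * (2 * L + 4 * M * κ) / (l₀ * t) ≤ κ ^ 2 * (4 * L + 8 * M) / (l * t) := by
      gcongr
    rw [e]
    calc _ = 2 * ((1 + κ) * (2 * L + 4 * M * κ) / (l₀ * t)) ^ 2 := by field_simp
      _ ≤ 2 * (κ ^ 2 * (4 * L + 8 * M) / (l * t)) ^ 2 := by gcongr
      _ = _ := by field_simp
  have h3 : 1 / t ^ 6 * (20 * lam ^ 2 * L ^ 2 * (410 * κ ^ 2 * (6 * A * D)))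
      ≤ 49200 * L ^ 2 * l' ^ 2 * D * (κ ^ 4 / t ^ 2) := by
    calc _ = 49200 * L ^ 2 * l₀ ^ 2 * D * (κ ^ 4 * A / t ^ 4) := by rw [hlam]; field_simp; ring
      _ ≤ 49200 * L ^ 2 * l' ^ 2 * D * (κ ^ 4 * t ^ 2 / t ^ 4) := by
        have : A ≤ t ^ 2 := by nlinarith
        gcongr
      _ = _ := by field_simp
  have h4 : 1 / t ^ 6 * (20 * lam ^ 2 * L ^ 2 * (410 * κ ^ 2 * (6 * A ^ 2 * t ^ 6
      * (α ^ 2 * (3 * bf ^ 2))))) ≤ A ^ 2 * (49200 * L ^ 2 * l' ^ 2 * (3 * a' ^ 2)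
        * (κ ^ 2 * bf ^ 2 / t ^ 4)) := by
    calc _ = A ^ 2 * (49200 * L ^ 2 * l₀ ^ 2 * (3 * α₀ ^ 2) * (1 * bf ^ 2 / (κ ^ 2 * t ^ 6))) := by
          rw [hlam, hα]; field_simp; ring
      _ ≤ A ^ 2 * (49200 * L ^ 2 * l' ^ 2 * (3 * a' ^ 2) * (κ ^ 2 * bf ^ 2 / (1 * t ^ 4))) := by
        have h := hp 0 2 (by norm_num)
        have h' := hq 4 6 (by norm_num)
        rw [pow_zero] at h
        gcongr
      _ = _ := by rw [one_mul]
  have h5 : 1 / t ^ 6 * (20 * lam ^ 2 * L ^ 2 * (410 * κ ^ 2 * (6 * A ^ 2 * t ^ 6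
      * (α ^ 2 * (72 * L ^ 2 * κ ^ 2))))) ≤ 49200 * L ^ 2 * l' ^ 2 * (72 * L ^ 2 * a' ^ 2)
        * (κ ^ 4 / t ^ 2) := by
    calc _ = 49200 * L ^ 2 * l₀ ^ 2 * (72 * L ^ 2 * α₀ ^ 2) * (1 * A ^ 2 / t ^ 6) := by
          rw [hlam, hα]; field_simp; ring
      _ ≤ 49200 * L ^ 2 * l' ^ 2 * (72 * L ^ 2 * a' ^ 2) * (κ ^ 4 * t ^ 4 / t ^ 6) := by
        have h := hp 0 4 (by norm_num)
        have h' := hq 1 4 (by norm_num)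
        rw [pow_zero] at h
        rw [pow_one] at h'
        have h2 := hAt.trans h'
        gcongr
      _ = _ := by field_simp
  have h6 : 1 / t ^ 6 * (20 * lam ^ 2 * L ^ 2 * (410 * κ ^ 2 * (6 * A ^ 2 * t ^ 6
      * (β ^ 2 * (3 * bf ^ 2))))) ≤ A ^ 2 * (49200 * L ^ 2 * l' ^ 2 * (3 * b' ^ 2)
        * (κ ^ 2 * bf ^ 2 / t ^ 4)) := by
    calc _ = A ^ 2 * (49200 * L ^ 2 * l₀ ^ 2 * (3 * β₀ ^ 2) * (κ ^ 2 * bf ^ 2 / t ^ 4)) := by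
          rw [hlam, hβ]; field_simp; ring
      _ ≤ _ := by gcongr
  have h7 : 1 / t ^ 6 * (20 * lam ^ 2 * L ^ 2 * (410 * κ ^ 2 * (6 * A ^ 2 * t ^ 6
      * (β ^ 2 * (3 * lam ^ 2 * bg ^ 2))))) ≤ A ^ 2 * (49200 * L ^ 2 * l' ^ 2
        * (3 * b' ^ 2 * l' ^ 2) * (κ ^ 4 * bg ^ 2 / t ^ 2)) := by
    calc _ = A ^ 2 * (49200 * L ^ 2 * l₀ ^ 2 * (3 * β₀ ^ 2 * l₀ ^ 2)
            * (κ ^ 4 * bg ^ 2 / t ^ 2)) := by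
          rw [hlam, hβ]; field_simp; ring
      _ ≤ _ := by gcongr
  have h8 : 1 / t ^ 6 * (20 * lam ^ 2 * L ^ 2 * (410 * κ ^ 2 * (6 * A ^ 2 * t ^ 6
      * (β ^ 2 * (96 * L ^ 2 * κ ^ 2))))) ≤ 49200 * L ^ 2 * l' ^ 2 * (96 * L ^ 2 * b' ^ 2)
        * (κ ^ 4 / t ^ 2) := by
    calc _ = 49200 * L ^ 2 * l₀ ^ 2 * (96 * L ^ 2 * β₀ ^ 2) * (κ ^ 4 * A ^ 2 / t ^ 4) := by
          rw [hlam, hβ]; field_simp; ring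
      _ ≤ 49200 * L ^ 2 * l' ^ 2 * (96 * L ^ 2 * b' ^ 2) * (κ ^ 4 * t ^ 2 / t ^ 4) := by
        have h' := hq 1 2 (by norm_num)
        rw [pow_one] at h'
        have h2 := hAt.trans h'
        gcongr
      _ = _ := by field_simp
  have h9 : 1 / t ^ 6 * (20 * lam ^ 2 * L ^ 2 * (410 * κ ^ 2 * (6 * A ^ 2 * t ^ 6
      * (γ ^ 2 * (2 * bg ^ 2))))) ≤ A ^ 2 * (49200 * L ^ 2 * l' ^ 2
        * (2 * c' ^ 2) * (κ ^ 4 * bg ^ 2 / t ^ 2)) := by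
    calc _ = A ^ 2 * (49200 * L ^ 2 * l₀ ^ 2 * (2 * γ₀ ^ 2) * (κ ^ 4 * bg ^ 2 / t ^ 2)) := by
          rw [hlam, hγ]; field_simp; ring
      _ ≤ _ := by gcongr
  have h10 : 1 / t ^ 6 * (20 * lam ^ 2 * L ^ 2 * (2 * ((4 * D + 4) / (β * (lam * (L / κ) / 2)))))
      ≤ 40 * L ^ 2 * l' ^ 2 * (2 * (4 * D + 4) / (b * l * L)) * (κ ^ 4 / t ^ 2) := by
    calc _ = 40 * L ^ 2 * l₀ ^ 2 * (2 * (4 * D + 4) / (β₀ * l₀ * L)) * (κ ^ 3 / t ^ 2) := by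
          rw [hlam, hβ]; field_simp; ring
      _ ≤ _ := by
        have := hp 3 4 (by norm_num)
        gcongr
  have h11 : 1 / t ^ 6 * (20 * lam ^ 2 * L ^ 2 * (2 * (2 * D / (γ * (L / κ)))))
      ≤ 40 * L ^ 2 * l' ^ 2 * (2 * D / (c * L)) * (κ ^ 4 / t ^ 2) := by
    calc _ = 40 * L ^ 2 * l₀ ^ 2 * (2 * D / (γ₀ * L)) * (κ ^ 3 / t ^ 2) := by
          rw [hlam, hγ]; field_simp; ring
      _ ≤ _ := by
        have := hp 3 4 (by norm_num)
        gcongr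
  linarith

set_option maxHeartbeats 1000000 in
/-- Smallness conditions on the parameters, for a large number `t⁶` of iterations. -/
lemma smallness_of_orders {B : ℝ} (hL : 0 < L) (hκ : 1 ≤ κ) (ht : 1 ≤ t) (hB : 0 ≤ B)
    (ha : 0 < a) (hb : 0 < b) (hc : 0 < c) (hl : 0 < l)
    (hα : α = α₀ / (κ ^ 3 * t ^ 4)) (hβ : β = β₀ / (κ * t ^ 3)) (hγ : γ = γ₀ / t ^ 2)
    (hlam : lam = l₀ * (κ * t)) (haα : a ≤ α₀) (hα' : α₀ ≤ a') (hbβ : b ≤ β₀) (hβ' : β₀ ≤ b')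
    (hcγ : c ≤ γ₀) (hγ' : γ₀ ≤ c') (hll : l ≤ l₀) (hl' : l₀ ≤ l')
    (ht1 : 2 / l ≤ t) (ht2 : 4 * a' * B ≤ t) (ht3 : 8 * b' * l' * L * κ ≤ t)
    (ht4 : c' * L * κ ≤ t)
    (ht5 : 2460 * κ ^ 2 * A ^ 2 * L ^ 2 * (18 * (a' * l') ^ 2 + 24 * (b' * l') ^ 2 + 2 * c' ^ 2)
      ≤ t)
    (ht6 : 80 * l' ^ 2 * a' ^ 2 * (768 / (b * l) ^ 2 + 12 / c ^ 2) ≤ t) :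
    1 ≤ lam ∧ 2 * κ ≤ lam ∧ α * B ≤ 1 / 4 ∧ β * (2 * lam * L) ^ 2 ≤ lam * (L / κ) / 2 ∧
    β * (lam * (L / κ) / 2) ≤ 1 ∧ γ * L ^ 2 ≤ L / κ ∧ γ * (L / κ) ≤ 1 ∧
    205 * κ ^ 2 * (6 * A ^ 2 * (18 * α ^ 2 * lam ^ 2 * L ^ 2
      + 24 * β ^ 2 * lam ^ 2 * L ^ 2 + 2 * γ ^ 2 * L ^ 2)) ≤ 1 / 2 ∧
    40 * lam ^ 2 * L ^ 2 * (192 * κ ^ 2 * α ^ 2 / (β * (lam * (L / κ) / 2)) ^ 2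
      + 12 * κ ^ 2 * α ^ 2 / (γ * (L / κ)) ^ 2) ≤ 1 / 2 := by
  have hκ0 : 0 < κ := by linarith
  have ht0 : 0 < t := by linarith
  have hα0 : 0 < α₀ := by linarith
  have hβ0 : 0 < β₀ := by linarith
  have hγ0 : 0 < γ₀ := by linarith
  have hl0 : 0 < l₀ := by linarith
  have ha0' : 0 < a' := by linarith
  have hb0' : 0 < b' := by linarith
  have hc0' : 0 < c' := by linarith
  have hl0' : 0 < l' := by linarith
  have hq : ∀ j : ℕ, 1 ≤ j → t ≤ t ^ j := fun j h => le_self_pow₀ ht (by omega)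
  have hκp : ∀ j : ℕ, 1 ≤ κ ^ j := fun j => one_le_pow₀ hκ
  have hbl : β₀ * l₀ ≤ b' * l' := by gcongr
  have hlam2 : 2 * κ ≤ lam := by
    rw [div_le_iff₀ hl] at ht1
    have h1 : 2 ≤ l₀ * t := by nlinarith
    rw [hlam]; nlinarith
  have hβlam : β * lam = β₀ * l₀ / t ^ 2 := by rw [hβ, hlam]; field_simp
  have hblt : b' * l' * L * κ ≤ t ^ 2 := by
    have := hq 2 (by norm_num)
    have h0 : 0 ≤ b' * l' * L * κ := by positivity
    linarith
  have hct : c' * L * κ ≤ t ^ 2 := ht4.trans (hq 2 (by norm_num))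
  refine ⟨by linarith, hlam2, ?_, ?_, ?_, ?_, ?_, ?_, ?_⟩
  · rw [hα, div_mul_eq_mul_div, div_le_iff₀ (by positivity)]
    have h1 : α₀ * B ≤ a' * B := by gcongr
    have h2 := hq 4 (by norm_num)
    have h3 : t ^ 4 ≤ κ ^ 3 * t ^ 4 := le_mul_of_one_le_left (by positivity) (hκp 3)
    linarith
  · have e : β * (2 * lam * L) ^ 2 = lam * (L / κ) / 2 * (8 * β₀ * l₀ * L * κ / t ^ 2) := by
      rw [hβ, hlam]; field_simp; ring
    rw [e]
    refine mul_le_of_le_one_right (by rw [hlam]; positivity) ?_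
    rw [div_le_one (by positivity)]
    refine le_trans ?_ (ht3.trans (hq 2 (by norm_num)))
    have : 8 * (β₀ * l₀) * (L * κ) ≤ 8 * (b' * l') * (L * κ) := by gcongr
    linarith
  · have e : β * (lam * (L / κ) / 2) = β₀ * l₀ * L / (2 * κ * t ^ 2) := by
      rw [hβ, hlam]; field_simp
    rw [e, div_le_one (by positivity)]
    have h1 : β₀ * l₀ * L ≤ b' * l' * L := by gcongr
    have h2 : b' * l' * L ≤ b' * l' * L * κ := le_mul_of_one_le_right (by positivity) hκ
    have h3 : t ^ 2 ≤ 2 * κ * t ^ 2 := le_mul_of_one_le_left (by positivity) (by linarith)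
    linarith
  · have e : γ * L ^ 2 = L / κ * (γ₀ * L * κ / t ^ 2) := by rw [hγ]; field_simp
    rw [e]
    refine mul_le_of_le_one_right (by positivity) ?_
    rw [div_le_one (by positivity)]
    refine le_trans ?_ hct
    gcongr
  · have e : γ * (L / κ) = γ₀ * L / (κ * t ^ 2) := by rw [hγ]; field_simp
    rw [e, div_le_one (by positivity)]
    have h1 : γ₀ * L ≤ c' * L := by gcongr
    have h2 : c' * L ≤ c' * L * κ := le_mul_of_one_le_right (by positivity) hκ
    have h3 : t ^ 2 ≤ κ * t ^ 2 := le_mul_of_one_le_left (by positivity) hκ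
    linarith
  · have e1 : α ^ 2 * lam ^ 2 = (α₀ * l₀) ^ 2 / (κ ^ 4 * t ^ 6) := by
      rw [hα, hlam]; field_simp
    have e2 : β ^ 2 * lam ^ 2 = (β₀ * l₀) ^ 2 / t ^ 4 := by
      rw [← mul_pow, hβlam]; field_simp
    have e3 : γ ^ 2 = γ₀ ^ 2 / t ^ 4 := by rw [hγ]; field_simp
    have h1 : (α₀ * l₀) ^ 2 / (κ ^ 4 * t ^ 6) ≤ (a' * l') ^ 2 / t ^ 4 := by
      have h2 : 1 * t ^ 4 ≤ κ ^ 4 * t ^ 6 :=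
        mul_le_mul (hκp 4) (pow_le_pow_right₀ ht (by norm_num)) (by positivity) (by positivity)
      rw [one_mul] at h2
      gcongr
    have h2 : (β₀ * l₀) ^ 2 / t ^ 4 ≤ (b' * l') ^ 2 / t ^ 4 := by gcongr
    have h3 : γ₀ ^ 2 / t ^ 4 ≤ c' ^ 2 / t ^ 4 := by gcongr
    rw [← e1] at h1
    rw [← e2] at h2
    rw [← e3] at h3
    calc _ = 1230 * κ ^ 2 * A ^ 2 * L ^ 2
          * (18 * (α ^ 2 * lam ^ 2) + 24 * (β ^ 2 * lam ^ 2) + 2 * γ ^ 2) := by ring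
      _ ≤ 1230 * κ ^ 2 * A ^ 2 * L ^ 2
          * (18 * ((a' * l') ^ 2 / t ^ 4) + 24 * ((b' * l') ^ 2 / t ^ 4)
            + 2 * (c' ^ 2 / t ^ 4)) := by gcongr
      _ = 2460 * κ ^ 2 * A ^ 2 * L ^ 2 * (18 * (a' * l') ^ 2 + 24 * (b' * l') ^ 2 + 2 * c' ^ 2)
          / (2 * t ^ 4) := by field_simp; ring
      _ ≤ 1 / 2 := by
        rw [div_le_iff₀ (by positivity)]
        have := hq 4 (by norm_num)
        linarith
  -- All powers of κ and L cancel: the order κ⁻³ of α is exactly what balances the drift of the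
  -- inner targets.
  · calc _ = 40 * l₀ ^ 2 * α₀ ^ 2 * (768 / (β₀ * l₀) ^ 2 + 12 / γ₀ ^ 2) / t ^ 2 := by
          rw [hα, hβ, hγ, hlam]; field_simp; ring
      _ ≤ 40 * l' ^ 2 * a' ^ 2 * (768 / (b * l) ^ 2 + 12 / c ^ 2) / t ^ 2 := by gcongr
      _ ≤ 1 / 2 := by
        rw [div_le_iff₀ (by positivity)]
        have := hq 2 (by norm_num)
        linarith

/-- All exponents of K in the step sizes are multiples of 1/6, so with t = K^(1/6) only natural
powers remain. -/
lemma rpow_neg_eq_div_pow {K : ℝ} (hK : 0 < K) {e : ℝ} {j : ℕ} (h : e = (j : ℝ) / 6) :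
    K ^ (-e) = 1 / (K ^ (1 / 6 : ℝ)) ^ j := by
  rw [Real.rpow_neg hK.le, one_div, ← Real.rpow_natCast, ← Real.rpow_mul hK.le, h]
  congr 2
  ring

end Rates

end

/-! ### Choice of the constants and conclusion -/

theorem corollary1
    -- smoothness and boundedness constants
    (Lf Lg Lg2 Cf : ℝ)
    -- constants in the orders of the step sizes and of the penalty parameter
    (a a' b b' c c' l l' : ℝ) (ha : 0 < a) (hb : 0 < b) (hc : 0 < c) (hl : 0 < l)
    -- bounds on the initial state
    (Δ D : ℝ) :
    ∃ C : ℝ, 0 < C ∧ ∀ μ ρ : ℝ, 0 < μ → ∃ K₀ : ℕ,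
      ∀ (m n r : ℕ) (_ : 0 < r)
        (G : SimpleGraph (Fin m)) (W : Matrix (Fin m) (Fin m) ℝ)
        (f g : Fin m → Vec n → Vec r → ℝ) (bf bg : ℝ) (s₀ : AheadState m (Vec n) (Vec r)),
        OuterAssumption f g Lf Cf →
        InnerAssumption g μ Lg Lg2 →
        NetworkAssumption G W →
        mixingRate W = ρ →
        BoundedHeterogeneity f g bf →
        BoundedHeterogeneity g g bg →
        InitialBound f g s₀ Δ D →
        Differentiable ℝ (bilevelObj f g) ∧
        ∀ K : ℕ, K₀ ≤ K → ∀ α β γ lam : ℝ,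
          OfOrder a a' (condNumber Lf Lg Cf μ ^ (-3 : ℝ) * (K : ℝ) ^ (-(2 / 3) : ℝ)) α →
          OfOrder b b' (condNumber Lf Lg Cf μ ^ (-1 : ℝ) * (K : ℝ) ^ (-(1 / 2) : ℝ)) β →
          OfOrder c c' ((K : ℝ) ^ (-(1 / 3) : ℝ)) γ →
          OfOrder l l' (condNumber Lf Lg Cf μ * (K : ℝ) ^ (1 / 6 : ℝ)) lam →
          (1 / (K : ℝ)) * ∑ k ∈ Finset.range K,
              ‖gradient (bilevelObj f g) (nodeAvg (ahead W f g α β γ lam s₀ k).x)‖ ^ 2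
            ≤ C * (condNumber Lf Lg Cf μ ^ 4 / (K : ℝ) ^ (1 / 3 : ℝ)
                + 1 / (1 - ρ) ^ 2 *
                  (condNumber Lf Lg Cf μ ^ 2 * bf ^ 2 / (K : ℝ) ^ (2 / 3 : ℝ)
                    + condNumber Lf Lg Cf μ ^ 4 * bg ^ 2 / (K : ℝ) ^ (1 / 3 : ℝ))) := by
  set L := max (max Lf Lg) Cf with hLdef
  set C₁ := 2 * Δ / a + 2 * ((4 * L + 8 * Lg2) / l) ^ 2 + 49200 * L ^ 2 * l' ^ 2 * D
    + 49200 * L ^ 2 * l' ^ 2 * (72 * L ^ 2 * a' ^ 2 + 96 * L ^ 2 * b' ^ 2)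
    + 40 * L ^ 2 * l' ^ 2 * (2 * (4 * D + 4) / (b * l * L) + 2 * D / (c * L)) with hC₁
  set C₂ := 49200 * L ^ 2 * l' ^ 2 * (3 * a' ^ 2 + 3 * b' ^ 2) with hC₂
  set C₃ := 49200 * L ^ 2 * l' ^ 2 * (3 * b' ^ 2 * l' ^ 2 + 2 * c' ^ 2) with hC₃
  -- The 1 secures positivity: at this point Δ, D and L are arbitrary reals, so C₁ may be negative.
  refine ⟨max 1 (max C₁ (max C₂ C₃)), lt_max_of_lt_left one_pos, fun μ ρ hμ => ?_⟩
  set C := max 1 (max C₁ (max C₂ C₃)) with hC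
  set κ := condNumber Lf Lg Cf μ with hκdef
  have hκL : L / μ = κ := rfl
  set A := 1 / (1 - ρ) with hA
  set B := (L + κ * Lg2) * (1 + κ ^ 2) with hB
  have hlim : Filter.Tendsto (fun K : ℕ => (K : ℝ) ^ (1 / 6 : ℝ)) Filter.atTop Filter.atTop :=
    (tendsto_rpow_atTop (by norm_num)).comp tendsto_natCast_atTop_atTop
  -- Each smallness condition is a lower bound on K^(1/6) in terms of μ, ρ and the fixed constants,
  -- hence a threshold chosen before the problem itself.
  obtain ⟨K₀, hK₀⟩ := Filter.eventually_atTop.1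
    (((((((hlim.eventually_ge_atTop 1).and (hlim.eventually_ge_atTop (A ^ 2))).and
      (hlim.eventually_ge_atTop (2 / l))).and (hlim.eventually_ge_atTop (4 * a' * B))).and
      (hlim.eventually_ge_atTop (8 * b' * l' * L * κ))).and
      (hlim.eventually_ge_atTop (c' * L * κ))).and
      ((hlim.eventually_ge_atTop (2460 * κ ^ 2 * A ^ 2 * L ^ 2
        * (18 * (a' * l') ^ 2 + 24 * (b' * l') ^ 2 + 2 * c' ^ 2))).and
      (hlim.eventually_ge_atTop (80 * l' ^ 2 * a' ^ 2 * (768 / (b * l) ^ 2 + 12 / c ^ 2)))))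
  refine ⟨max 1 K₀, ?_⟩
  intro m n r hr G W f g bf bg s₀ hf hg hW hρ hhf hhg h0
  have hm := hW.node_pos
  have : Nonempty (Fin r) := ⟨⟨0, hr⟩⟩
  have hLf : Lf ≤ L := (le_max_left _ _).trans (le_max_left _ _)
  have hLg : Lg ≤ L := (le_max_right _ _).trans (le_max_left _ _)
  have hCf : Cf ≤ L := le_max_right _ _
  have data := bilevelData_of_assumptions hf hg hμ hm hLf hLg
  have hys : ∀ x, (meanGrad g (pt x (innerSol g x))).snd = 0 := fun x =>
    hg.snd_meanGrad_innerSol hμ (data.exists_innerZero x)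
  have S : AheadSetting L Lg2 μ bf bg G W f g :=
    { data := data
      f_lip := fun i p q => ((hf.smooth i).2 p q).trans
        (mul_le_mul_of_nonneg_right hLf (norm_nonneg _))
      g_lip := fun i p q => ((hg.smooth i).2 p q).trans
        (mul_le_mul_of_nonneg_right hLg (norm_nonneg _))
      f_grad := fun i => (hf.smooth i).hasGradientAt_nodeGrad
      g_grad := fun i => (hg.smooth i).hasGradientAt_nodeGrad
      ys_zero := hys
      f_bound := fun x => by
        rw [snd_meanGrad]
        refine norm_nodeAvg_le hm fun i => ?_
        have := hf.bounded i x
        rw [((hf.smooth i).hasGradientAt_nodeGrad _).gradY_eq] at this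
        exact this.trans hCf
      het_f := hhf
      het_g := hhg
      net := hW }
  refine ⟨?_, fun K hK α β γ lam hα hβ hγ hlam => ?_⟩
  · obtain ⟨h, hquad, -⟩ := S.data.exists_hypergradient S.ys_zero S.f_bound
    exact fun x => (hasGradientAt_of_quadratic_bound (Φ := bilevelObj f g) hquad x).differentiableAt
  obtain ⟨⟨⟨⟨⟨⟨ht, hAt⟩, ht1⟩, ht2⟩, ht3⟩, ht4⟩, ht5, ht6⟩ :=
    hK₀ K ((le_max_right _ _).trans hK)
  have hK0 : (0 : ℝ) < K := by exact_mod_cast lt_of_lt_of_le one_pos ((le_max_left _ _).trans hK)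
  have hL := data.L_pos
  have hM := data.M_nonneg
  have hκ : 1 ≤ κ := by
    rw [← hκL, le_div_iff₀ hμ, one_mul]; exact data.mu_le inferInstance
  have hκ0 : 0 < κ := by linarith
  have hμL : μ = L / κ := by rw [← hκL]; field_simp
  have hD : 0 ≤ D := (consensusError_nonneg _).trans h0.cons_x
  have hΔ : 0 ≤ Δ := by simpa using h0.gap (nodeAvg s₀.x)
  have hρ0 : 0 ≤ ρ := hρ ▸ mixingRate_nonneg
  have hρ1 : 0 < 1 - ρ := sub_pos.2 (hρ ▸ hW.mixingRate_lt_one)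
  have hA1 : 1 ≤ A := by rw [hA, le_div_iff₀ hρ1]; linarith
  have e6 : (K : ℝ) = ((K : ℝ) ^ (1 / 6 : ℝ)) ^ 6 := by
    rw [← Real.rpow_natCast, ← Real.rpow_mul hK0.le]; norm_num
  have e13 : (K : ℝ) ^ (1 / 3 : ℝ) = ((K : ℝ) ^ (1 / 6 : ℝ)) ^ 2 := by
    rw [← Real.rpow_natCast, ← Real.rpow_mul hK0.le]; norm_num
  have e23 : (K : ℝ) ^ (2 / 3 : ℝ) = ((K : ℝ) ^ (1 / 6 : ℝ)) ^ 4 := by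
    rw [← Real.rpow_natCast, ← Real.rpow_mul hK0.le]; norm_num
  rw [rpow_neg_eq_div_pow hK0 (j := 4) (by norm_num), Real.rpow_neg hκ0.le,
    show (3 : ℝ) = ((3 : ℕ) : ℝ) by norm_num, Real.rpow_natCast] at hα
  rw [rpow_neg_eq_div_pow hK0 (j := 3) (by norm_num), Real.rpow_neg_one] at hβ
  rw [rpow_neg_eq_div_pow hK0 (j := 2) (by norm_num)] at hγ
  rw [e13, e23]
  set t := (K : ℝ) ^ (1 / 6 : ℝ) with ht_def
  have ht0 : 0 < t := by linarith
  have eα : (κ ^ 3)⁻¹ * (1 / t ^ 4) = 1 / (κ ^ 3 * t ^ 4) := by field_simp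
  have eβ : κ⁻¹ * (1 / t ^ 3) = 1 / (κ * t ^ 3) := by field_simp
  -- Splits a step size into its exact order 1/s and a coefficient lying between the two prescribed
  -- constants.
  have normalize : ∀ {p q s x : ℝ}, 0 < s → OfOrder p q (1 / s) x →
      x = (x * s) / s ∧ p ≤ x * s ∧ x * s ≤ q := by
    intro p q s x hs h
    obtain ⟨h1, h2⟩ := h
    rw [mul_one_div] at h1 h2
    exact ⟨by field_simp, (div_le_iff₀ hs).1 h1, (le_div_iff₀ hs).1 h2⟩
  rw [eα] at hα
  rw [eβ] at hβ
  obtain ⟨hα1, hα2, hα3⟩ := normalize (by positivity) hα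
  obtain ⟨hβ1, hβ2, hβ3⟩ := normalize (by positivity) hβ
  obtain ⟨hγ1, hγ2, hγ3⟩ := normalize (by positivity) hγ
  have hlam1 : lam = lam / (κ * t) * (κ * t) := by field_simp
  have hlam2 : l ≤ lam / (κ * t) := (le_div_iff₀ (by positivity)).2 hlam.1
  have hlam3 : lam / (κ * t) ≤ l' := (div_le_iff₀ (by positivity)).2 hlam.2
  have hα0 : 0 < α := by rw [hα1]; have := ha.trans_le hα2; positivity
  have hβ0 : 0 < β := by rw [hβ1]; have := hb.trans_le hβ2; positivity
  have hγ0 : 0 < γ := by rw [hγ1]; have := hc.trans_le hγ2; positivity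
  obtain ⟨s1, s2, s3, s4, s5, s6, s7, s8, s9⟩ := smallness_of_orders (B := B) (A := A) hL hκ ht
    (by positivity) ha hb hc hl hα1 hβ1 hγ1 hlam1 hα2 hα3 hβ2 hβ3 hγ2 hγ3 hlam2 hlam3
    ht1 ht2 ht3 ht4 ht5 ht6
  have hmain := S.sum_norm_gradient_sq_le hr h0 (α := α) (β := β) (γ := γ) (lam := lam) s1
    (by rwa [hκL]) hα0 hβ0 hγ0 (by rwa [hκL]) (by rwa [hμL]) (by rwa [hμL]) (by rwa [hμL])
    (by rwa [hμL]) (by rwa [hκL, hρ]) (by rw [hκL, hμL]; exact s9) K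
  rw [hκL, hρ, ← hA] at hmain
  have hrate := rate_of_orders (bf := bf) (bg := bg) hL hM hκ ht hA1 hAt hD hΔ ha hb hc hl
    hα1 hβ1 hγ1 hlam1 hα2 hα3 hβ2 hβ3 hγ2 hγ3 hlam2 hlam3
  rw [← hC₁, ← hC₂, ← hC₃, ← hμL, ← e6] at hrate
  have hfin := (mul_le_mul_of_nonneg_left hmain (by positivity : 0 ≤ 1 / (K : ℝ))).trans hrate
  refine hfin.trans ?_
  have eA : A ^ 2 = 1 / (1 - ρ) ^ 2 := by rw [hA]; field_simp
  have hC1 : C₁ ≤ C := (le_max_left _ _).trans (le_max_right _ _)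
  have hC2 : C₂ ≤ C := (le_max_left _ _).trans ((le_max_right _ _).trans (le_max_right _ _))
  have hC3 : C₃ ≤ C := (le_max_right _ _).trans ((le_max_right _ _).trans (le_max_right _ _))
  rw [← eA]
  calc _ ≤ C * (κ ^ 4 / t ^ 2) + A ^ 2 * (C * (κ ^ 2 * bf ^ 2 / t ^ 4)
        + C * (κ ^ 4 * bg ^ 2 / t ^ 2)) := by gcongr
    _ = _ := by ring
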